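/- Let $V$ be a real vector space, $\mathcal F\subseteq V$ convex, $\mathcal Y$ a real Hilbert space, $K:V\to\mathcal Y$ and $L:V\to\mathbb R$ linear, $\sigma>0$ and $\alpha\in(0,1)$. One observes $Y=Kf+\sigma\varepsilon$, $f\in\mathcal F$ unknown, where $\varepsilon$ is standard Gaussian on $\mathcal Y$, i.e. $\langle\varepsilon,y\rangle$ is linear in $y$ and $\langle\varepsilon,y\rangle\sim\mathcal N(0,\|y\|^2)$ for each $y\in\mathcal Y$. Write $P_f,E_f$ for probability and expectation when the parameter is $f$, $\lambda$ for Lebesgue measure, and $\mathcal I_\alpha$ for the collection of all $1-\alpha$ confidence sets, i.e. measurable random sets $\mathcal C=\mathcal C(Y)\subseteq\mathbb R$ with $\inf_{f\in\mathcal F}P_f(Lf\in\mathcal C)\ge 1-\alpha$. For an estimator $\hat L=\hat L(Y)$ let $$\chi_\alpha(\hat L)=\min\{\chi:\inf_{f\in\mathcal F}P_f(|\hat L-Lf|\le\chi)\ge1-\alpha\}$$ be the half-length of the shortest fixed-length $1-\alpha$ confidence interval centered at $\hat L$. Let $z_p$ be the $p$-quantile of $\mathcal N(0,1)$ and $\mathrm{cv}_\alpha(t)$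 the $1-\alpha$ quantile of $|\mathcal N(t,1)|$. Let $$\omega(\delta)=\omega(\delta;\mathcal F)=\sup\{Lg_1-Lf_1:\ f_1,g_1\in\mathcal F,\ \|K(g_1-f_1)\|\le\delta\}.$$ Assume that for every $\delta>0$ the supremum is attained, at $(f^*_\delta,g^*_\delta)$ say, let $\omega'(\delta)$ be an arbitrary element of the superdifferential $\{d:\omega(\eta)\le\omega(\delta)+d(\eta-\delta)\ \forall\eta>0\}$, and put, with $f^*_{M,\delta}=(f^*_\delta+g^*_\delta)/2$, $$\hat L_{\delta,\mathcal F}=Lf^*_{M,\delta}+\frac{\omega'(\delta)}{\delta}\langle K(g^*_\delta-f^*_\delta),\,Y-Kf^*_{M,\delta}\rangle .$$ Let $\delta_\chi>0$ be a minimizer of $\chi_\alpha(\hat L_{\delta,\mathcal F})$ over $\delta>0$ (assumed to exist). Let $g\in\mathcal F$, and assume that for every $L_0\in\mathbb R$ there is a minimizer of $\|K(g-f)\|$ subject to $f\in\mathcal F$, $Lf=L_0$. Assume in addition that $\mathcal F$ is centrosymmetric ($f\in\mathcal F\Rightarrow -f\in\mathcal F$) and that $f-g\in\mathcal F$ for all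 $f\in\mathcal F$. Then the minimum defining $\chi_\alpha(\hat L_{\delta_\chi,\mathcal F})$ is attained and positive, $\inf_{\mathcal C\in\mathcal I_\alpha}E_g\lambda(\mathcal C(Y))$ is finite, and the efficiency at $g$ of the fixed-length confidence interval around $\hat L_{\delta_\chi,\mathcal F}$ relative to all confidence sets is $$\frac{\inf_{\mathcal C\in\mathcal I_\alpha}E_g\lambda(\mathcal C(Y))}{2\chi_\alpha(\hat L_{\delta_\chi,\mathcal F})}=\frac{(1-\alpha)\,E[\omega(2\sigma(z_{1-\alpha}-Z);\mathcal F)\mid Z\le z_{1-\alpha}]}{2\,\mathrm{cv}_\alpha\!\left(\frac{\omega(\delta_\chi;\mathcal F)}{2\sigma\omega'(\delta_\chi;\mathcal F)}-\frac{\delta_\chi}{2\sigma}\right)\sigma\,\omega'(\delta_\chi;\mathcal F)},$$ where $Z$ is standard normal and the conditional expectation is finite. -/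

import Mathlib

open MeasureTheory ProbabilityTheory
open scoped NNReal ENNReal

noncomputable section

namespace HonestCI

variable {V 𝒴 Ω : Type*} [AddCommGroup V] [Module ℝ V]
  [NormedAddCommGroup 𝒴] [InnerProductSpace ℝ 𝒴] [MeasurableSpace Ω]

/-! ### Quantiles -/

/-- The `p`-quantile of a probability distribution on the real line. -/
def quantile (μ : Measure ℝ) (p : ℝ) : ℝ := sInf {x : ℝ | p ≤ cdf μ x}

/-- `z_p`, the `p`-quantile of the standard normal distribution. -/
def zq (p : ℝ) : ℝ := quantile (gaussianReal 0 1) p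

/-- `cv_α(t)`, the `1 - α` quantile of the absolute value of a `N(t, 1)` variable. -/
def cv (α t : ℝ) : ℝ := quantile ((gaussianReal t 1).map (fun x => |x|)) (1 - α)

/-! ### The model `Y = K f + σ ε`

The Hilbert space may be infinite dimensional, in which case `ε` is not an element of it. As usual,
`ε` is the family of real random variables `ε y = ⟨ε, y⟩`, and the observation `Y` is the family
`⟨Y, y⟩ = ⟨K f, y⟩ + σ ⟨ε, y⟩`, a point of `𝒴 → ℝ` with the product σ-algebra. -/

/-- `ε` is standard Gaussian noise on `𝒴`: `⟨ε, y⟩` is (almost surely) linear in `y`, and it is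
normal with mean zero and variance `‖y‖ ^ 2`. -/
structure IsStandardGaussian (ε : 𝒴 → Ω → ℝ) (P : Measure Ω) : Prop where
  measurable : ∀ y, Measurable (ε y)
  linear : ∀ (a b : ℝ) (y z : 𝒴),
    ∀ᵐ w ∂P, ε (a • y + b • z) w = a * ε y w + b * ε z w
  law : ∀ y, P.map (ε y) = gaussianReal 0 (‖y‖₊ ^ 2)

/-- The observation `Y` when the parameter is `f`. -/
def observation (K : V →ₗ[ℝ] 𝒴) (σ : ℝ) (ε : 𝒴 → Ω → ℝ) (f : V) (w : Ω) : 𝒴 → ℝ :=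
  fun y => inner ℝ (K f) y + σ * ε y w

/-- `P_f`, the distribution of the observation when the parameter is `f`. -/
def dataLaw (K : V →ₗ[ℝ] 𝒴) (σ : ℝ) (ε : 𝒴 → Ω → ℝ) (P : Measure Ω) (f : V) :
    Measure (𝒴 → ℝ) :=
  P.map (observation K σ ε f)

/-! ### Confidence sets -/

/-- `𝓘_α`, the collection of all `1 - α` confidence sets for `L f` over `F`. -/
def confidenceSets (F : Set V) (K : V →ₗ[ℝ] 𝒴) (L : V →ₗ[ℝ] ℝ) (σ : ℝ)
    (ε : 𝒴 → Ω → ℝ) (P : Measure Ω) (α : ℝ) : Set ((𝒴 → ℝ) → Set ℝ) :=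
  {C | MeasurableSet {p : (𝒴 → ℝ) × ℝ | p.2 ∈ C p.1} ∧
    ∀ f ∈ F, ENNReal.ofReal (1 - α) ≤ dataLaw K σ ε P f {y | L f ∈ C y}}

/-- `E_g λ(C(Y))`, the expected Lebesgue measure of a confidence set when the parameter is `g`. -/
def expectedLength (K : V →ₗ[ℝ] 𝒴) (σ : ℝ) (ε : 𝒴 → Ω → ℝ) (P : Measure Ω)
    (g : V) (C : (𝒴 → ℝ) → Set ℝ) : ℝ≥0∞ :=
  ∫⁻ y, volume (C y) ∂(dataLaw K σ ε P g)

/-- `inf_{C ∈ 𝓘_α} E_g λ(C(Y))`. -/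
def optimalExpectedLength (F : Set V) (K : V →ₗ[ℝ] 𝒴) (L : V →ₗ[ℝ] ℝ) (σ : ℝ)
    (ε : 𝒴 → Ω → ℝ) (P : Measure Ω) (α : ℝ) (g : V) : ℝ≥0∞ :=
  ⨅ C ∈ confidenceSets F K L σ ε P α, expectedLength K σ ε P g C

/-- The `χ` for which `[Lhat - χ, Lhat + χ]` has coverage at least `1 - α` over `F`. -/
def validHalfLengths (F : Set V) (K : V →ₗ[ℝ] 𝒴) (L : V →ₗ[ℝ] ℝ) (σ : ℝ)
    (ε : 𝒴 → Ω → ℝ) (P : Measure Ω) (α : ℝ) (Lhat : (𝒴 → ℝ) → ℝ) : Set ℝ :=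
  {χ | ∀ f ∈ F, ENNReal.ofReal (1 - α) ≤ dataLaw K σ ε P f {y | |Lhat y - L f| ≤ χ}}

/-- `χ_α(Lhat)`, the half-length of the shortest fixed-length `1 - α` confidence interval centered
at the estimator `Lhat`. -/
def halfLength (F : Set V) (K : V →ₗ[ℝ] 𝒴) (L : V →ₗ[ℝ] ℝ) (σ : ℝ)
    (ε : 𝒴 → Ω → ℝ) (P : Measure Ω) (α : ℝ) (Lhat : (𝒴 → ℝ) → ℝ) : ℝ :=
  sInf (validHalfLengths F K L σ ε P α Lhat)

/-! ### The modulus of continuity and the associated estimators -/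

/-- The (single-class) modulus of continuity `ω(δ; F)`. The supremum is finite for every `δ` as soon
as the modulus problem has a solution for one `δ > 0` and `F` is convex and nonempty. -/
def modulus (F : Set V) (K : V →ₗ[ℝ] 𝒴) (L : V →ₗ[ℝ] ℝ) (δ : ℝ) : ℝ :=
  sSup {r : ℝ | ∃ f ∈ F, ∃ g ∈ F, ‖K (g - f)‖ ≤ δ ∧ r = L g - L f}

/-- The pair `(f, g)` solves the modulus problem at `δ`. -/
def IsModulusSolution (F : Set V) (K : V →ₗ[ℝ] 𝒴) (L : V →ₗ[ℝ] ℝ) (δ : ℝ) (f g : V) : Prop :=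
  f ∈ F ∧ g ∈ F ∧ ‖K (g - f)‖ ≤ δ ∧
    ∀ f' ∈ F, ∀ g' ∈ F, ‖K (g' - f')‖ ≤ δ → L g' - L f' ≤ L g - L f

/-- The superdifferential of the modulus at `δ`. -/
def modulusSuperdiff (F : Set V) (K : V →ₗ[ℝ] 𝒴) (L : V →ₗ[ℝ] ℝ) (δ : ℝ) : Set ℝ :=
  {d | ∀ η > 0, modulus F K L η ≤ modulus F K L δ + d * (η - δ)}

/-- The affine estimator
`L f_M + (d / δ) ⟨K (g - f), Y - K f_M⟩`, with midpoint `f_M = (f + g) / 2`; it is the estimator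
`Lhat_{δ, F}` when `(f, g)` solves the modulus problem at `δ` and `d` is in the superdifferential. -/
def modulusEstimator (K : V →ₗ[ℝ] 𝒴) (L : V →ₗ[ℝ] ℝ) (δ d : ℝ) (f g : V) (y : 𝒴 → ℝ) : ℝ :=
  L ((1 / 2 : ℝ) • (f + g)) +
    d / δ * (y (K (g - f)) - inner ℝ (K ((1 / 2 : ℝ) • (f + g))) (K (g - f)))

end HonestCI

end

/-! Numerator. By Tonelli, `E_g λ(C) = ∫ P_g(t ∈ C) dt`. Let `φ t` minimize `‖K (g - f)‖` over `f ∈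
F` with `L f = t`. Coverage at `φ t` and the Neyman–Pearson lemma force `P_g(t ∈ C) ≥ Φ(z - ‖K (g -
φ t)‖ / σ)` with `z = z_{1-α}` (`dataLaw_neyman_pearson`). One set attains this bound for all `t` at
once: invert the tests of `φ t` against `g`. Convexity makes `φ t` least favorable among all `f ∈ F`
with `L f = t`, so these tests keep their level (`exists_optimal_confidenceSet`). A second use of
Tonelli turns `∫ Φ(z - ‖K (g - φ t)‖ / σ) dt` into the expectation over `Z < z` of the length of `{t
| ‖K (g - φ t)‖ ≤ σ (z - Z)}`. By centrosymmetry this is an interval around `L g` of length `ω(2σ(z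
- Z))` (`setOf_norm_minimizers_le`). The factor `1 - α = P(Z ≤ z)` converts the truncated
expectation into a conditional one.

Denominator. `Lhat_δ` is normal with standard deviation `σ ω'(δ)`. The supporting hyperplane
inequality for the concave modulus bounds its absolute bias over `F` by `(ω(δ) - δ ω'(δ)) / 2`, a
value attained at `f*_δ`. Coverage decreases in the absolute bias, so the half-length is `σ ω'(δ)`
times `cv_α` of the standardized worst bias (`validHalfLengths_modulusEstimator`). -/

namespace HonestCI

/-! ### Quantiles, coverage of Gaussian intervals, and the scalar Neyman–Pearson lemma. -/

open Filter Topology in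
/-- The Galois connection between the quantile function and the distribution function. -/
theorem le_cdf_iff_quantile_le (μ : Measure ℝ) {p x : ℝ} (hp0 : 0 < p) (hp1 : p < 1) :
    p ≤ cdf μ x ↔ quantile μ p ≤ x := by
  have hbdd : BddBelow {x : ℝ | p ≤ cdf μ x} := by
    obtain ⟨a, ha⟩ := ((tendsto_cdf_atBot μ).eventually (gt_mem_nhds hp0)).exists
    refine ⟨a, fun y hy => ?_⟩
    by_contra! h
    exact absurd (hy.trans (monotone_cdf μ h.le)) (not_le.2 ha)
  have hne : {x : ℝ | p ≤ cdf μ x}.Nonempty := by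
    obtain ⟨a, ha⟩ := ((tendsto_cdf_atTop μ).eventually (lt_mem_nhds hp1)).exists
    exact ⟨a, le_of_lt ha⟩
  refine ⟨fun h => csInf_le hbdd h, fun h => ?_⟩
  refine le_trans ?_ (monotone_cdf μ h)
  by_contra! hlt
  -- Right continuity keeps the cdf below `p` slightly to the right of the infimum, where the set
  -- already has points.
  have hr := ((cdf μ).right_continuous (quantile μ p)).eventually (gt_mem_nhds hlt)
  obtain ⟨b, hb, hab⟩ := ((hr.filter_mono (nhdsWithin_mono _ Set.Ioi_subset_Ici_self)).and
    self_mem_nhdsWithin).exists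
  obtain ⟨s, hs, hsb⟩ := exists_lt_of_csInf_lt hne hab
  exact absurd (le_trans hs (monotone_cdf μ hsb.le)) (not_le.2 hb)

open Filter Topology in
theorem cdf_quantile (μ : Measure ℝ) [IsProbabilityMeasure μ] {p : ℝ} (hp0 : 0 < p) (hp1 : p < 1)
    (hμ : μ {quantile μ p} = 0) : cdf μ (quantile μ p) = p := by
  apply le_antisymm _ ((le_cdf_iff_quantile_le μ hp0 hp1).2 le_rfl)
  rw [← measure_cdf μ, StieltjesFunction.measure_singleton, measure_cdf,
    ENNReal.ofReal_eq_zero] at hμ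
  have h1 := (monotone_cdf μ).tendsto_leftLim (quantile μ p)
  have h2 : Function.leftLim (cdf μ) (quantile μ p) ≤ p := by
    refine le_of_tendsto h1 ?_
    filter_upwards [self_mem_nhdsWithin] with y hy
    by_contra! h
    exact absurd ((le_cdf_iff_quantile_le μ hp0 hp1).1 h.le) (not_le.2 hy)
  linarith

theorem gaussianReal_Iic_zq {p : ℝ} (hp0 : 0 < p) (hp1 : p < 1) :
    gaussianReal 0 1 (Set.Iic (zq p)) = ENNReal.ofReal p := by
  have := nullSingletonClass_gaussianReal (μ := 0) (v := 1) one_ne_zero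
  rw [← ofReal_cdf, zq, cdf_quantile _ hp0 hp1 (measure_singleton _)]

theorem gaussianReal_setOf_abs_add_neg (b x : ℝ) :
    gaussianReal 0 1 {z | |(-b) + z| ≤ x} = gaussianReal 0 1 {z | |b + z| ≤ x} := by
  have h : (gaussianReal 0 1).map (fun x => -x) = gaussianReal 0 1 := by
    rw [gaussianReal_map_neg, neg_zero]
  conv_rhs => rw [← h]
  rw [Measure.map_apply measurable_neg (measurableSet_le (by fun_prop) (by fun_prop))]
  congr 1
  ext z
  simp only [Set.mem_ofPred_eq, Set.mem_preimage]
  rw [← abs_neg]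
  simp [add_comm]

theorem gaussianPDFReal_zero_one_le {s t : ℝ} (h : |s| ≤ |t|) :
    gaussianPDFReal 0 1 t ≤ gaussianPDFReal 0 1 s := by
  simp only [gaussianPDFReal, sub_zero]
  have := sq_le_sq.2 h
  gcongr

/-- The derivative in `b` is the density at `x + b` minus the density at `x - b`, and `|x - b| ≤ x +
b`. -/
theorem antitoneOn_intervalIntegral_gaussianPDFReal {x : ℝ} (hx : 0 ≤ x) :
    AntitoneOn (fun b => ∫ s in (-x - b)..(x - b), gaussianPDFReal 0 1 s) (Set.Ici 0) := by
  have hc : Continuous (gaussianPDFReal 0 1) := by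
    simp only [gaussianPDFReal_def]
    fun_prop
  have hi : ∀ u v, IntervalIntegrable (gaussianPDFReal 0 1) volume u v :=
    fun u v => hc.intervalIntegrable u v
  have hd : ∀ b, HasDerivAt (fun b => ∫ s in (-x - b)..(x - b), gaussianPDFReal 0 1 s)
      (gaussianPDFReal 0 1 (-x - b) - gaussianPDFReal 0 1 (x - b)) b := by
    intro b
    have h1 : HasDerivAt (fun b => ∫ s in (0 : ℝ)..(x - b), gaussianPDFReal 0 1 s)
        (gaussianPDFReal 0 1 (x - b) * (-1)) b :=
      (intervalIntegral.integral_hasDerivAt_right (hi _ _)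
        (hc.stronglyMeasurableAtFilter _ _) hc.continuousAt).comp b
        ((hasDerivAt_id b).const_sub x)
    have h2 : HasDerivAt (fun b => ∫ s in (0 : ℝ)..(-x - b), gaussianPDFReal 0 1 s)
        (gaussianPDFReal 0 1 (-x - b) * (-1)) b :=
      (intervalIntegral.integral_hasDerivAt_right (hi _ _)
        (hc.stronglyMeasurableAtFilter _ _) hc.continuousAt).comp b
        ((hasDerivAt_id b).const_sub (-x))
    refine ((h1.sub h2).congr_deriv (by ring)).congr_of_eventuallyEq (.of_forall fun b => ?_)
    exact (intervalIntegral.integral_interval_sub_left (hi _ _) (hi _ _)).symm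
  refine antitoneOn_of_deriv_nonpos (convex_Ici 0)
    (fun b _ => (hd b).continuousAt.continuousWithinAt)
    (fun b _ => (hd b).differentiableAt.differentiableWithinAt) fun b hb => ?_
  rw [(hd b).deriv, sub_nonpos]
  rw [interior_Ici, Set.mem_Ioi] at hb
  apply gaussianPDFReal_zero_one_le
  rw [show -x - b = -(x + b) by ring, abs_neg, abs_of_nonneg (by linarith : 0 ≤ x + b), abs_le]
  constructor <;> linarith

/-- The standard Gaussian measure of an interval of fixed length decreases as the interval moves
away from the origin. -/
theorem gaussianReal_setOf_abs_add_le_anti {b c : ℝ} (h : |b| ≤ |c|) (x : ℝ) :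
    gaussianReal 0 1 {z | |c + z| ≤ x} ≤ gaussianReal 0 1 {z | |b + z| ≤ x} := by
  have habs : ∀ a : ℝ, gaussianReal 0 1 {z | |a + z| ≤ x}
      = gaussianReal 0 1 {z | |(|a|) + z| ≤ x} := by
    intro a
    rcases abs_choice a with h | h
    · rw [h]
    · rw [h, gaussianReal_setOf_abs_add_neg]
  rcases lt_or_ge x 0 with hx | hx
  · have : {z : ℝ | |c + z| ≤ x} = ∅ :=
      Set.eq_empty_of_forall_notMem fun z hz => absurd (hz.trans_lt hx) (abs_nonneg _).not_gt
    simp [this]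
  · have hint : ∀ a : ℝ, gaussianReal 0 1 {z | |a + z| ≤ x}
        = ENNReal.ofReal (∫ s in (-x - a)..(x - a), gaussianPDFReal 0 1 s) := by
      intro a
      have : {z : ℝ | |a + z| ≤ x} = Set.Icc (-x - a) (x - a) := by
        ext z
        simp only [Set.mem_ofPred_eq, abs_le, Set.mem_Icc]
        constructor <;> rintro ⟨_, _⟩ <;> constructor <;> linarith
      rw [this, gaussianReal_apply_eq_integral _ one_ne_zero, integral_Icc_eq_integral_Ioc,
        intervalIntegral.integral_of_le (by linarith)]
    rw [habs b, habs c, hint, hint]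
    exact ENNReal.ofReal_le_ofReal (antitoneOn_intervalIntegral_gaussianPDFReal hx
      (abs_nonneg b) (abs_nonneg c) h)

theorem cdf_map_abs_gaussianReal (t x : ℝ) :
    ENNReal.ofReal (cdf ((gaussianReal t 1).map (fun x => |x|)) x)
      = gaussianReal 0 1 {z | |t + z| ≤ x} := by
  have : IsProbabilityMeasure ((gaussianReal t 1).map (fun x => |x|)) :=
    Measure.isProbabilityMeasure_map (by fun_prop)
  have h : (gaussianReal 0 1).map (fun x => t + x) = gaussianReal t 1 := by
    rw [gaussianReal_map_const_add, zero_add]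
  rw [ofReal_cdf, ← h, Measure.map_map (by fun_prop) (by fun_prop),
    Measure.map_apply (by fun_prop) measurableSet_Iic]
  rfl

/-- A half-length `x` gives coverage `1 - α` to `|N(t, 1)|` iff it is at least `cv α t`. -/
theorem le_gaussianReal_setOf_abs_iff_cv_le {α : ℝ} (hα0 : 0 < α) (hα1 : α < 1) (t x : ℝ) :
    ENNReal.ofReal (1 - α) ≤ gaussianReal 0 1 {z | |t + z| ≤ x} ↔ cv α t ≤ x := by
  rw [← cdf_map_abs_gaussianReal, ENNReal.ofReal_le_ofReal_iff (cdf_nonneg _ _), cv]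
  exact le_cdf_iff_quantile_le _ (by linarith) (by linarith)

theorem cv_pos {α : ℝ} (hα0 : 0 < α) (hα1 : α < 1) (t : ℝ) : 0 < cv α t := by
  have := nullSingletonClass_gaussianReal (μ := 0) (v := 1) one_ne_zero
  by_contra! h
  have h1 := (le_gaussianReal_setOf_abs_iff_cv_le hα0 hα1 t 0).2 h
  have h2 : {z : ℝ | |t + z| ≤ 0} = {-t} := by
    ext z
    simp only [abs_nonpos_iff, Set.mem_ofPred_eq, Set.mem_singleton_iff]
    constructor <;> intro h <;> linarith
  rw [h2, measure_singleton, nonpos_iff_eq_zero, ENNReal.ofReal_eq_zero] at h1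
  linarith

theorem gaussianReal_eq_withDensity (δ : ℝ) :
    gaussianReal δ 1 = (gaussianReal 0 1).withDensity
      (fun s => ENNReal.ofReal (Real.exp (δ * s - δ ^ 2 / 2))) := by
  rw [gaussianReal_of_var_ne_zero _ one_ne_zero, gaussianReal_of_var_ne_zero _ one_ne_zero,
    ← withDensity_mul _ (by fun_prop) (by fun_prop)]
  congr 1
  ext s
  simp only [gaussianPDF, Pi.mul_apply]
  rw [← ENNReal.ofReal_mul (gaussianPDFReal_nonneg _ _ _)]
  congr 1
  simp only [gaussianPDFReal, mul_assoc, ← Real.exp_add]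
  congr 3
  simp
  ring

/-- The Neyman–Pearson lemma for a shift of the standard normal distribution, for randomized
tests. -/
theorem gaussianReal_neyman_pearson {δ z : ℝ} (hδ : 0 ≤ δ) {h : ℝ → ℝ≥0∞} (hm : Measurable h)
    (h1 : ∀ s, h s ≤ 1) (hle : gaussianReal 0 1 (Set.Iic z) ≤ ∫⁻ s, h s ∂gaussianReal 0 1) :
    gaussianReal δ 1 (Set.Iic z) ≤ ∫⁻ s, h s ∂gaussianReal δ 1 := by
  set γ := gaussianReal 0 1 with hγ
  set l : ℝ → ℝ≥0∞ := fun s => ENNReal.ofReal (Real.exp (δ * s - δ ^ 2 / 2)) with hl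
  have hlm : Measurable l := by fun_prop
  have hmono : Monotone l := fun s t hst => by
    apply ENNReal.ofReal_le_ofReal
    gcongr
  have hsplit : ∀ k : ℝ → ℝ≥0∞, ∫⁻ s, k s ∂γ = ∫⁻ s in Set.Iic z, k s ∂γ
      + ∫⁻ s in Set.Ioi z, k s ∂γ := fun k => by
    rw [← Set.compl_Iic, lintegral_add_compl _ measurableSet_Iic]
  have hfin : ∫⁻ s in Set.Iic z, h s ∂γ ≠ ⊤ := by
    refine ne_top_of_le_ne_top (b := γ (Set.Iic z)) (measure_ne_top _ _) ?_
    calc _ ≤ ∫⁻ s in Set.Iic z, 1 ∂γ := lintegral_mono h1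
      _ = _ := by simp
  -- The null mass that `h` gives up on `Iic z` must be recovered on `Ioi z`. The likelihood ratio
  -- `l` is at most `l z` on the left and at least `l z` on the right, so the exchange can only
  -- raise the mass under the shift.
  have hcompl : ∫⁻ s in Set.Iic z, (1 - h s) ∂γ ≤ ∫⁻ s in Set.Ioi z, h s ∂γ := by
    have : ∫⁻ s in Set.Iic z, h s ∂γ + ∫⁻ s in Set.Iic z, (1 - h s) ∂γ = γ (Set.Iic z) := by
      rw [← lintegral_add_left hm]
      simp [add_tsub_cancel_of_le (h1 _)]
    rw [← this, hsplit h] at hle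
    exact (ENNReal.add_le_add_iff_left hfin).1 hle
  rw [gaussianReal_eq_withDensity δ, withDensity_apply _ measurableSet_Iic,
    lintegral_withDensity_eq_lintegral_mul _ hlm hm, hsplit]
  calc ∫⁻ s in Set.Iic z, l s ∂γ
      = ∫⁻ s in Set.Iic z, (l * h) s ∂γ + ∫⁻ s in Set.Iic z, l s * (1 - h s) ∂γ := by
        rw [← lintegral_add_left (hlm.mul hm)]
        refine lintegral_congr fun s => ?_
        rw [Pi.mul_apply, ← mul_add, add_tsub_cancel_of_le (h1 _), mul_one]
    _ ≤ ∫⁻ s in Set.Iic z, (l * h) s ∂γ + ∫⁻ s in Set.Iic z, l z * (1 - h s) ∂γ := by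
        gcongr 1
        refine setLIntegral_mono (by fun_prop) fun s hs => ?_
        gcongr
        exact hmono hs
    _ = ∫⁻ s in Set.Iic z, (l * h) s ∂γ + l z * ∫⁻ s in Set.Iic z, (1 - h s) ∂γ := by
        rw [lintegral_const_mul _ (by fun_prop)]
    _ ≤ ∫⁻ s in Set.Iic z, (l * h) s ∂γ + l z * ∫⁻ s in Set.Ioi z, h s ∂γ := by gcongr
    _ = ∫⁻ s in Set.Iic z, (l * h) s ∂γ + ∫⁻ s in Set.Ioi z, l z * h s ∂γ := by
        rw [lintegral_const_mul _ hm]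
    _ ≤ _ := by
        gcongr 1
        refine setLIntegral_mono (hlm.mul hm) fun s hs => ?_
        rw [Pi.mul_apply]
        gcongr
        exact hmono (le_of_lt hs)

/-! ### The noise as a Gaussian process, and testing between two parameters. -/

section Noise

variable {V 𝒴 Ω : Type*} [AddCommGroup V] [Module ℝ V]
  [NormedAddCommGroup 𝒴] [InnerProductSpace ℝ 𝒴] [MeasurableSpace Ω]
  {P : Measure Ω} {ε : 𝒴 → Ω → ℝ}

theorem IsStandardGaussian.ae_sum (hε : IsStandardGaussian ε P) {ι : Type*} (I : Finset ι)
    (c : ι → ℝ) (x : ι → 𝒴) :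
    ∀ᵐ w ∂P, ε (∑ i ∈ I, c i • x i) w = ∑ i ∈ I, c i * ε (x i) w := by
  classical
  induction I using Finset.induction_on with
  | empty =>
    filter_upwards [hε.linear 0 0 0 0] with w hw
    simpa using hw
  | insert a s ha ih =>
    filter_upwards [ih, hε.linear (c a) 1 (x a) (∑ i ∈ s, c i • x i)] with w h1 h2
    rw [Finset.sum_insert ha, Finset.sum_insert ha, ← h1]
    simpa using h2

theorem IsStandardGaussian.map_eq (hε : IsStandardGaussian ε P) (u : 𝒴) :
    P.map (ε u) = (gaussianReal 0 1).map (fun x => ‖u‖ * x) := by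
  rw [hε.law, gaussianReal_map_const_mul]
  congr 1
  · simp
  · ext; simp

theorem IsStandardGaussian.measure_setOf (hε : IsStandardGaussian ε P) (u : 𝒴) {p : ℝ → Prop}
    (hp : MeasurableSet {x | p x}) :
    P {w | p (ε u w)} = gaussianReal 0 1 {x | p (‖u‖ * x)} := by
  have h1 : P.map (ε u) {x | p x} = P {w | p (ε u w)} :=
    Measure.map_apply (hε.measurable u) hp
  rw [← h1, hε.map_eq, Measure.map_apply (by fun_prop) hp]
  rfl

/-- Almost sure linearity makes every linear functional of finitely many coordinates a single
coordinate `ε u`, which is normal. -/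
theorem IsStandardGaussian.isGaussianProcess [IsProbabilityMeasure P]
    (hε : IsStandardGaussian ε P) : IsGaussianProcess ε P where
  hasGaussianLaw I := by
    classical
    refine ⟨isGaussian_of_isGaussian_map fun l => ?_⟩
    have hm : Measurable (fun w => I.restrict (fun u => ε u w)) :=
      measurable_pi_lambda _ fun i => hε.measurable i
    rw [Measure.map_map (by fun_prop) hm]
    have : (l ∘ fun w => I.restrict (fun u => ε u w))
        =ᵐ[P] ε (∑ i : I, l (Pi.single i 1) • (i : 𝒴)) := by
      filter_upwards [hε.ae_sum Finset.univ (fun i : I => l (Pi.single i 1)) (fun i : I => (i : 𝒴))]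
        with w hw
      rw [hw, Function.comp_apply]
      conv_lhs => rw [pi_eq_sum_univ' (I.restrict (fun u => ε u w))]
      simp only [map_sum, map_smul, smul_eq_mul]
      refine Finset.sum_congr rfl fun i _ => ?_
      rw [mul_comm]
      congr 2
    rw [Measure.map_congr this, hε.law]
    infer_instance

theorem IsStandardGaussian.memLp_two [IsProbabilityMeasure P] (hε : IsStandardGaussian ε P)
    (u : 𝒴) : MemLp (ε u) 2 P :=
  (hε.isGaussianProcess.hasGaussianLaw_eval u).memLp_two

theorem IsStandardGaussian.variance_eq (hε : IsStandardGaussian ε P)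
    (u : 𝒴) : Var[ε u; P] = ‖u‖ ^ 2 := by
  have h := variance_map (X := id) (Y := ε u) (μ := P) aemeasurable_id (hε.measurable u).aemeasurable
  rw [hε.law, variance_id_gaussianReal] at h
  simpa using h.symm

theorem IsStandardGaussian.covariance_eq_zero [IsProbabilityMeasure P]
    (hε : IsStandardGaussian ε P) {u v : 𝒴} (huv : inner ℝ u v = 0) : cov[ε u, ε v; P] = 0 := by
  have h := variance_add (hε.memLp_two u) (hε.memLp_two v)
  have h1 : ε u + ε v =ᵐ[P] ε (u + v) := by
    filter_upwards [hε.linear 1 1 u v] with w hw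
    simpa using hw.symm
  rw [variance_congr h1, hε.variance_eq, hε.variance_eq, hε.variance_eq,
    norm_add_sq_real, huv] at h
  linarith

theorem measurable_observation (hε : IsStandardGaussian ε P) (K : V →ₗ[ℝ] 𝒴) (σ : ℝ) (f : V) :
    Measurable (observation K σ ε f) :=
  measurable_pi_lambda _ fun u => ((hε.measurable u).const_mul σ).const_add _

theorem isProbabilityMeasure_dataLaw [IsProbabilityMeasure P] (hε : IsStandardGaussian ε P)
    (K : V →ₗ[ℝ] 𝒴) (σ : ℝ) (f : V) : IsProbabilityMeasure (dataLaw K σ ε P f) :=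
  Measure.isProbabilityMeasure_map (measurable_observation hε K σ f).aemeasurable

/-- The law of a single coordinate of the observation. -/
theorem dataLaw_setOf (hε : IsStandardGaussian ε P) (K : V →ₗ[ℝ] 𝒴) (σ : ℝ) (f : V) (u : 𝒴)
    {p : ℝ → Prop} (hp : MeasurableSet {x | p x}) :
    dataLaw K σ ε P f {y | p (y u)}
      = gaussianReal 0 1 {x | p (inner ℝ (K f) u + σ * (‖u‖ * x))} := by
  have h1 : MeasurableSet {y : 𝒴 → ℝ | p (y u)} := measurable_pi_apply u hp
  have h2 : MeasurableSet {x : ℝ | p (inner ℝ (K f) u + σ * x)} :=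
    (by fun_prop : Measurable fun x : ℝ => inner ℝ (K f) u + σ * x) hp
  rw [dataLaw, Measure.map_apply (measurable_observation hε K σ f) h1]
  exact hε.measure_setOf u h2

/-- The noise in the direction of a unit vector is independent of the noise in the orthogonal
directions. -/
theorem IsStandardGaussian.map_prodMk [IsProbabilityMeasure P] (hε : IsStandardGaussian ε P)
    {e : 𝒴} (he : ‖e‖ = 1) :
    P.map (fun w => ((fun u => ε (u - inner ℝ e u • e) w : 𝒴 → ℝ), ε e w))
      = (P.map (fun w => (fun u => ε (u - inner ℝ e u • e) w : 𝒴 → ℝ))).prod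
        (gaussianReal 0 1) := by
  have hX : Measurable (fun w => (fun u => ε (u - inner ℝ e u • e) w : 𝒴 → ℝ)) :=
    measurable_pi_lambda _ fun u => hε.measurable _
  have hG : IsGaussianProcess (Sum.elim (fun u : 𝒴 => ε (u - inner ℝ e u • e))
      (fun _ : Unit => ε e)) P := by
    have h := Sum.comp_elim ε (fun u : 𝒴 => u - inner ℝ e u • e) (fun _ : Unit => e)
    exact (h ▸ hε.isGaussianProcess.comp_right _ :)
  have hi := hG.indepFun_of_covariance_eq_zero (fun u => (hε.measurable _).aemeasurable)
    (fun _ => (hε.measurable _).aemeasurable) (fun u _ => hε.covariance_eq_zero (by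
      rw [inner_sub_left, inner_smul_left, real_inner_self_eq_norm_sq, he, real_inner_comm]
      simp))
  have hi2 : IndepFun (fun w => (fun u => ε (u - inner ℝ e u • e) w : 𝒴 → ℝ)) (ε e) P :=
    hi.comp measurable_id (measurable_pi_apply ())
  rw [(indepFun_iff_map_prod_eq_prod_map_map hX.aemeasurable
    (hε.measurable e).aemeasurable).1 hi2, hε.law]
  congr 2
  ext
  simp [he]

theorem dataLaw_eq_map_prod [IsProbabilityMeasure P] (hε : IsStandardGaussian ε P)
    (K : V →ₗ[ℝ] 𝒴) (σ : ℝ) (f : V) {e : 𝒴} (he : ‖e‖ = 1) :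
    dataLaw K σ ε P f
      = ((P.map (fun w => (fun u => ε (u - inner ℝ e u • e) w : 𝒴 → ℝ))).prod
        (gaussianReal 0 1)).map
        (fun q u => inner ℝ (K f) u + σ * (q.1 u + q.2 * inner ℝ e u)) := by
  have hX : Measurable (fun w => ((fun u => ε (u - inner ℝ e u • e) w : 𝒴 → ℝ), ε e w)) :=
    (measurable_pi_lambda _ fun u => hε.measurable _).prodMk (hε.measurable e)
  have hT : Measurable (fun (q : (𝒴 → ℝ) × ℝ) (u : 𝒴) =>
      inner ℝ (K f) u + σ * (q.1 u + q.2 * inner ℝ e u)) := by fun_prop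
  rw [← hε.map_prodMk he, Measure.map_map hT hX, dataLaw]
  -- A law on the product σ-algebra is determined by its finite-dimensional marginals, so almost
  -- sure equality of each coordinate suffices.
  refine map_eq_of_forall_ae_eq (measurable_observation hε K σ f).aemeasurable
    (hT.comp hX).aemeasurable fun u => ?_
  filter_upwards [hε.linear 1 (inner ℝ e u) (u - inner ℝ e u • e) e] with w hw
  simp only [one_smul, sub_add_cancel] at hw
  simp only [observation, hw, Function.comp_apply]
  ring

theorem gaussianReal_Iic_eq (δ z : ℝ) :
    gaussianReal δ 1 (Set.Iic z) = gaussianReal 0 1 (Set.Iic (z - δ)) := by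
  have h : (gaussianReal 0 1).map (fun x => x + δ) = gaussianReal δ 1 := by
    rw [gaussianReal_map_add_const, zero_add]
  rw [← h, Measure.map_apply (by fun_prop) measurableSet_Iic]
  congr 1
  ext x
  simp [le_sub_iff_add_le]

/-- A bound on the error of a test between two parameters: if the acceptance region `A` has
probability at least `Φ(z)` under `f`, its probability under `g` is at least
`Φ(z - ‖K (g - f)‖ / σ)`. -/
theorem dataLaw_neyman_pearson [IsProbabilityMeasure P] (hε : IsStandardGaussian ε P)
    (K : V →ₗ[ℝ] 𝒴) {σ : ℝ} (hσ : 0 < σ) (f g : V) {A : Set (𝒴 → ℝ)} (hA : MeasurableSet A)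
    {z : ℝ} (hle : gaussianReal 0 1 (Set.Iic z) ≤ dataLaw K σ ε P f A) :
    gaussianReal 0 1 (Set.Iic (z - ‖K (g - f)‖ / σ)) ≤ dataLaw K σ ε P g A := by
  by_cases hv : K (g - f) = 0
  · have : K g = K f := by rwa [map_sub, sub_eq_zero] at hv
    have h2 : dataLaw K σ ε P g = dataLaw K σ ε P f := by
      unfold dataLaw observation
      rw [this]
    simpa [hv, h2] using hle
  have hn : 0 < ‖K (g - f)‖ := norm_pos_iff.2 hv
  set e : 𝒴 := ‖K (g - f)‖⁻¹ • K (g - f) with he_def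
  have he : ‖e‖ = 1 := by
    rw [he_def, norm_smul, norm_inv, norm_norm, inv_mul_cancel₀ hn.ne']
  have hKg : K g = K f + ‖K (g - f)‖ • e := by
    rw [he_def, smul_inv_smul₀ hn.ne', map_sub, add_sub_cancel]
  set ρ := P.map (fun w => (fun u => ε (u - inner ℝ e u • e) w : 𝒴 → ℝ)) with hρ
  have : IsProbabilityMeasure ρ := Measure.isProbabilityMeasure_map
    (measurable_pi_lambda _ fun u => hε.measurable _).aemeasurable
  set T : V → (𝒴 → ℝ) × ℝ → 𝒴 → ℝ :=
    fun h q u => inner ℝ (K h) u + σ * (q.1 u + q.2 * inner ℝ e u) with hT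
  have hTm : ∀ h, Measurable (T h) := fun h => by
    simp only [hT]
    fun_prop
  have hlaw : ∀ h, dataLaw K σ ε P h A
      = ∫⁻ s, ρ ((fun r => (r, s)) ⁻¹' (T h ⁻¹' A)) ∂gaussianReal 0 1 := fun h => by
    rw [dataLaw_eq_map_prod hε K σ h he, Measure.map_apply (hTm h) hA,
      Measure.prod_apply_symm (hTm h hA)]
  -- Integrating out the noise orthogonal to `e` leaves a randomized test in the one coordinate that
  -- separates `f` from `g`. Passing from `f` to `g` shifts that coordinate by `‖K (g - f)‖ / σ`.
  set H : ℝ → ℝ≥0∞ := fun s => ρ ((fun r => (r, s)) ⁻¹' (T f ⁻¹' A)) with hH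
  have hHm : Measurable H := measurable_measure_prodMk_right (hTm f hA)
  have hg : dataLaw K σ ε P g A = ∫⁻ s, H s ∂gaussianReal (‖K (g - f)‖ / σ) 1 := by
    have h : (gaussianReal 0 1).map (fun x => x + ‖K (g - f)‖ / σ)
        = gaussianReal (‖K (g - f)‖ / σ) 1 := by
      rw [gaussianReal_map_add_const, zero_add]
    rw [hlaw, ← h, lintegral_map hHm (by fun_prop)]
    refine lintegral_congr fun s => ?_
    congr 1
    ext r
    have : T g (r, s) = T f (r, s + ‖K (g - f)‖ / σ) := by
      ext u
      simp only [hT]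
      rw [hKg, inner_add_left, inner_smul_left]
      simp only [conj_trivial]
      field_simp
      ring
    simp only [Set.mem_preimage, this]
  rw [hg, ← gaussianReal_Iic_eq]
  refine gaussianReal_neyman_pearson (by positivity) hHm (fun s => prob_le_one) ?_
  rwa [hlaw] at hle

end Noise

/-! ### Joint measurability of the observation along a curve. -/

section Modification

variable {V 𝒴 Ω : Type*} [AddCommGroup V] [Module ℝ V]
  [NormedAddCommGroup 𝒴] [InnerProductSpace ℝ 𝒴] [MeasurableSpace Ω]
  {P : Measure Ω} {ε : 𝒴 → Ω → ℝ}

open Filter Topology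

theorem IsStandardGaussian.lintegral_sq (hε : IsStandardGaussian ε P) (u : 𝒴) :
    ∫⁻ w, ENNReal.ofReal (ε u w ^ 2) ∂P
      = ENNReal.ofReal (‖u‖ ^ 2) * ∫⁻ x, ENNReal.ofReal (x ^ 2) ∂gaussianReal 0 1 := by
  have h : ∫⁻ x, ENNReal.ofReal (x ^ 2) ∂(P.map (ε u)) = ∫⁻ w, ENNReal.ofReal (ε u w ^ 2) ∂P :=
    lintegral_map (by fun_prop) (hε.measurable u)
  rw [← h, hε.map_eq, lintegral_map (by fun_prop) (by fun_prop),
    ← lintegral_const_mul _ (by fun_prop)]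
  refine lintegral_congr fun x => ?_
  rw [mul_pow, ENNReal.ofReal_mul (by positivity)]

theorem lintegral_sq_gaussianReal_ne_top :
    ∫⁻ x, ENNReal.ofReal (x ^ 2) ∂gaussianReal 0 1 ≠ ⊤ := by
  have h : Integrable (fun x : ℝ => x ^ 2) (gaussianReal 0 1) :=
    (memLp_id_gaussianReal' 2 (by simp)).integrable_sq
  exact (h.lintegral_lt_top).ne

/-- The second moments are summable, so the sum of the squares is almost surely finite. -/
theorem IsStandardGaussian.ae_tendsto_zero (hε : IsStandardGaussian ε P) {u : ℕ → 𝒴}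
    (hu : ∀ n, ‖u n‖ ≤ (1 / 2) ^ n) : ∀ᵐ w ∂P, Tendsto (fun n => ε (u n) w) atTop (𝓝 0) := by
  have hm : ∀ n, Measurable fun w => ENNReal.ofReal (ε (u n) w ^ 2) := fun n =>
    ((hε.measurable _).pow_const 2).ennreal_ofReal
  have hsum : ∫⁻ w, ∑' n, ENNReal.ofReal (ε (u n) w ^ 2) ∂P ≠ ⊤ := by
    rw [lintegral_tsum fun n => (hm n).aemeasurable]
    simp_rw [hε.lintegral_sq]
    rw [ENNReal.tsum_mul_right]
    refine ENNReal.mul_ne_top ?_ lintegral_sq_gaussianReal_ne_top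
    have hs : Summable fun n => ‖u n‖ ^ 2 := by
      refine Summable.of_nonneg_of_le (fun n => by positivity) (fun n => ?_)
        (summable_geometric_of_lt_one (r := 1 / 4) (by norm_num) (by norm_num))
      calc ‖u n‖ ^ 2 ≤ ((1 / 2) ^ n) ^ 2 := by gcongr; exact hu n
        _ = (1 / 4) ^ n := by rw [← pow_mul, mul_comm, pow_mul]; norm_num
    exact hs.tsum_ofReal_ne_top
  filter_upwards [ae_lt_top' (AEMeasurable.tsum fun n => (hm n).aemeasurable) hsum]
    with w hw
  have h0 := ENNReal.tendsto_atTop_zero_of_tsum_ne_top hw.ne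
  have h1 : Tendsto (fun n => ε (u n) w ^ 2) atTop (𝓝 0) := by
    have := (ENNReal.tendsto_toReal ENNReal.zero_ne_top).comp h0
    simpa [Function.comp_def, ENNReal.toReal_ofReal, sq_nonneg] using this
  have h2 := h1.sqrt
  simp only [Real.sqrt_sq_eq_abs, Real.sqrt_zero] at h2
  exact (tendsto_zero_iff_abs_tendsto_zero _).2 h2

/-- Along a continuous curve `v` in `𝒴`, the observation has a jointly measurable modification. -/
theorem exists_measurable_modification (hε : IsStandardGaussian ε P) (K : V →ₗ[ℝ] 𝒴) (σ : ℝ)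
    {v : ℝ → 𝒴} (hv : Continuous v) :
    ∃ X : (𝒴 → ℝ) × ℝ → ℝ, Measurable X ∧
      ∀ f t, ∀ᵐ y ∂dataLaw K σ ε P f, X (y, t) = y (v t) := by
  classical
  obtain ⟨q, hq⟩ := TopologicalSpace.exists_dense_seq ℝ
  have hex : ∀ (n : ℕ) (t : ℝ), ∃ j, ‖v (q j) - v t‖ < (1 / 2) ^ n := by
    intro n t
    have hopen : IsOpen {s | ‖v s - v t‖ < (1 / 2) ^ n} :=
      isOpen_lt (by fun_prop) continuous_const
    obtain ⟨_, hs, j, rfl⟩ := hq.inter_open_nonempty _ hopen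
      ⟨t, by simp⟩
    exact ⟨j, hs⟩
  -- `idx n t` is the first index in a dense sequence whose point on the curve is within `2⁻ⁿ` of `v
  -- t`. It is countably valued and measurable in `t`, so reading the observation there is jointly
  -- measurable. The `limsup` recovers `y (v t)` off a null set depending on `t`.
  obtain ⟨idx, hidxm, hidxs⟩ : ∃ idx : ℕ → ℝ → ℕ, (∀ n, Measurable (idx n)) ∧
      ∀ n t, ‖v (q (idx n t)) - v t‖ < (1 / 2) ^ n :=
    ⟨fun n t => Nat.find (hex n t), fun n => measurable_find (hex n) fun k =>
      (isOpen_lt (by fun_prop) continuous_const).measurableSet, fun n t => Nat.find_spec (hex n t)⟩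
  have hXm : ∀ n, Measurable fun p : (𝒴 → ℝ) × ℝ => p.1 (v (q (idx n p.2))) := fun n => by
    have h1 : Measurable fun p : (𝒴 → ℝ) × ℕ => p.1 (v (q p.2)) :=
      measurable_from_prod_countable_left fun j => measurable_pi_apply (v (q j))
    exact h1.comp (measurable_fst.prodMk ((hidxm n).comp measurable_snd))
  have hlim : Measurable fun p : (𝒴 → ℝ) × ℝ => limsup (fun n => p.1 (v (q (idx n p.2)))) atTop :=
    Measurable.limsup hXm
  refine ⟨_, hlim, fun f t => ?_⟩
  have hlim_t : Measurable fun y : 𝒴 → ℝ => limsup (fun n => y (v (q (idx n t)))) atTop :=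
    Measurable.limsup fun n => measurable_pi_apply (v (q (idx n t)))
  have hms : MeasurableSet {y : 𝒴 → ℝ |
      limsup (fun n => y (v (q (idx n t)))) atTop = y (v t)} :=
    measurableSet_eq_fun hlim_t (measurable_pi_apply (v t))
  rw [dataLaw, ae_map_iff (measurable_observation hε K σ f).aemeasurable hms]
  have hlin : ∀ᵐ w ∂P, ∀ n, ε (v (q (idx n t))) w
      = ε (v (q (idx n t)) - v t) w + ε (v t) w := by
    rw [ae_all_iff]
    intro n
    filter_upwards [hε.linear 1 1 (v (q (idx n t)) - v t) (v t)] with w hw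
    simpa using hw
  filter_upwards [hlin, hε.ae_tendsto_zero fun n => (hidxs n t).le] with w h1 h2
  refine Tendsto.limsup_eq ?_
  have h3 : Tendsto (fun n => v (q (idx n t))) atTop (𝓝 (v t)) := by
    rw [tendsto_iff_norm_sub_tendsto_zero]
    exact squeeze_zero (fun _ => norm_nonneg _) (fun n => (hidxs n t).le)
      (tendsto_pow_atTop_nhds_zero_of_lt_one (by norm_num) (by norm_num))
  have h4 : Tendsto (fun n => ε (v (q (idx n t))) w) atTop (𝓝 (ε (v t) w)) := by
    simp_rw [h1]
    simpa using h2.add_const (ε (v t) w)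
  exact (tendsto_const_nhds.inner h3).add (h4.const_mul σ)

end Modification

/-- This extracts first-order conditions: perturb along a segment of length `t`, divide by `t`, and
let `t → 0`. -/
theorem le_of_forall_le_add_mul {a b c : ℝ} (h : ∀ t, 0 < t → t ≤ 1 → a ≤ b + t * c) : a ≤ b := by
  have h1 : Filter.Tendsto (fun t : ℝ => b + t * c) (nhdsWithin 0 (Set.Ioi 0)) (nhds b) := by
    have : Continuous fun t : ℝ => b + t * c := by fun_prop
    simpa using (this.tendsto 0).mono_left nhdsWithin_le_nhds
  refine ge_of_tendsto h1 ?_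
  filter_upwards [Ioc_mem_nhdsGT (zero_lt_one' ℝ)] with t ht
  exact h t ht.1 ht.2

/-! ### The modulus of continuity and its supporting hyperplanes. -/

section Modulus

variable {V 𝒴 : Type*} [AddCommGroup V] [Module ℝ V]
  [NormedAddCommGroup 𝒴] [InnerProductSpace ℝ 𝒴]
  {F : Set V} {K : V →ₗ[ℝ] 𝒴} {L : V →ₗ[ℝ] ℝ}

theorem IsModulusSolution.isGreatest {δ : ℝ} {f g : V} (h : IsModulusSolution F K L δ f g) :
    IsGreatest {r : ℝ | ∃ f ∈ F, ∃ g ∈ F, ‖K (g - f)‖ ≤ δ ∧ r = L g - L f} (L g - L f) :=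
  ⟨⟨f, h.1, g, h.2.1, h.2.2.1, rfl⟩, by
    rintro _ ⟨f', hf', g', hg', hn, rfl⟩
    exact h.2.2.2 f' hf' g' hg' hn⟩

theorem IsModulusSolution.modulus_eq {δ : ℝ} {f g : V} (h : IsModulusSolution F K L δ f g) :
    modulus F K L δ = L g - L f :=
  h.isGreatest.csSup_eq

theorem IsModulusSolution.le_modulus {δ : ℝ} {f g f' g' : V} (h : IsModulusSolution F K L δ f g)
    (hf' : f' ∈ F) (hg' : g' ∈ F) (hn : ‖K (g' - f')‖ ≤ δ) : L g' - L f' ≤ modulus F K L δ := by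
  rw [h.modulus_eq]
  exact h.2.2.2 f' hf' g' hg' hn

theorem modulus_nonneg (hne : F.Nonempty) (hsol : ∀ δ > 0, ∃ f g, IsModulusSolution F K L δ f g)
    (δ : ℝ) : 0 ≤ modulus F K L δ := by
  obtain ⟨g, hg⟩ := hne
  rcases lt_or_ge δ 0 with hδ | hδ
  · apply Real.sSup_nonneg
    rintro _ ⟨f, _, g, _, hn, rfl⟩
    exact absurd (hn.trans_lt hδ) (norm_nonneg _).not_gt
  · obtain ⟨f', g', h⟩ := hsol (δ + 1) (by linarith)
    refine le_csSup ⟨L g' - L f', ?_⟩ ⟨g, hg, g, hg, by simpa using hδ, by simp⟩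
    rintro _ ⟨f₁, hf₁, g₁, hg₁, hn, rfl⟩
    exact h.2.2.2 f₁ hf₁ g₁ hg₁ (by linarith)

theorem modulus_monotone (hne : F.Nonempty)
    (hsol : ∀ δ > 0, ∃ f g, IsModulusSolution F K L δ f g) : Monotone (modulus F K L) := by
  intro a b hab
  rcases lt_or_ge a 0 with ha | ha
  -- For negative `a` no pair is feasible and `sSup ∅ = 0`.
  · have : modulus F K L a = 0 := by
      have h : {r : ℝ | ∃ f ∈ F, ∃ g ∈ F, ‖K (g - f)‖ ≤ a ∧ r = L g - L f} = ∅ := by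
        refine Set.eq_empty_of_forall_notMem ?_
        rintro _ ⟨f, _, g, _, hn, rfl⟩
        exact absurd (hn.trans_lt ha) (norm_nonneg _).not_gt
      rw [modulus, h, Real.sSup_empty]
    rw [this]
    exact modulus_nonneg hne hsol b
  · obtain ⟨g, hg⟩ := hne
    obtain ⟨f', g', h⟩ := hsol (b + 1) (by linarith)
    refine csSup_le_csSup ⟨L g' - L f', ?_⟩ ⟨0, g, hg, g, hg, by simpa using ha, by simp⟩ ?_
    · rintro _ ⟨f₁, hf₁, g₁, hg₁, hn, rfl⟩
      exact h.2.2.2 f₁ hf₁ g₁ hg₁ (by linarith)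
    · rintro _ ⟨f₁, hf₁, g₁, hg₁, hn, rfl⟩
      exact ⟨f₁, hf₁, g₁, hg₁, hn.trans hab, rfl⟩

/-- If `L` takes every value on `F`, the modulus is unbounded, so that its supergradients are
positive. -/
theorem modulusSuperdiff_pos (hne : F.Nonempty)
    (hsol : ∀ δ > 0, ∃ f g, IsModulusSolution F K L δ f g) (hL : ∀ t : ℝ, ∃ f ∈ F, L f = t)
    {δ d : ℝ} (hδ : 0 < δ) (hd : d ∈ modulusSuperdiff F K L δ) : 0 < d := by
  by_contra! hd0
  obtain ⟨g, hg⟩ := hne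
  obtain ⟨f, hf, hLf⟩ := hL (L g + modulus F K L δ + 1)
  have hη : 0 < max δ ‖K (f - g)‖ := lt_max_of_lt_left hδ
  obtain ⟨f', g', h⟩ := hsol _ hη
  have h1 := h.le_modulus hg hf (le_max_right _ _)
  have h2 := hd _ hη
  have h3 : d * (max δ ‖K (f - g)‖ - δ) ≤ 0 :=
    mul_nonpos_of_nonpos_of_nonneg hd0 (sub_nonneg.2 (le_max_left _ _))
  linarith

/-- A slack constraint would let some smaller `η` reach the same value `ω(δ)`, contradicting the
positive supergradient. -/
theorem IsModulusSolution.norm_eq (hsol : ∀ δ > 0, ∃ f g, IsModulusSolution F K L δ f g)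
    {δ d : ℝ} (hδ : 0 < δ) (hd : d ∈ modulusSuperdiff F K L δ) (hd0 : 0 < d)
    {f g : V} (h : IsModulusSolution F K L δ f g) : ‖K (g - f)‖ = δ := by
  refine le_antisymm h.2.2.1 ?_
  by_contra! hlt
  set η := max (δ / 2) ‖K (g - f)‖
  have hη : 0 < η := lt_max_of_lt_left (by linarith)
  have hηδ : η < δ := max_lt (by linarith) hlt
  obtain ⟨f', g', h'⟩ := hsol η hη
  have h1 := h'.le_modulus h.1 h.2.1 (le_max_right _ _)
  have h2 := hd η hη
  rw [← h.modulus_eq] at h1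
  nlinarith

/-- The supporting hyperplane inequality at a solution of the modulus problem. -/
theorem IsModulusSolution.sub_modulus_le (hF : Convex ℝ F)
    (hsol : ∀ δ > 0, ∃ f g, IsModulusSolution F K L δ f g)
    {δ d : ℝ} (hδ : 0 < δ) (hd : d ∈ modulusSuperdiff F K L δ) (hd0 : 0 < d)
    {f g : V} (h : IsModulusSolution F K L δ f g) {f' g' : V} (hf' : f' ∈ F) (hg' : g' ∈ F) :
    L g' - L f' - modulus F K L δ
      ≤ d / δ * inner ℝ (K (g - f)) (K (g' - f') - K (g - f)) := by
  set u := K (g - f) with hu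
  set x := K (g' - f') - u with hx
  have hn : ‖u‖ = δ := h.norm_eq hsol hδ hd hd0
  refine le_of_forall_le_add_mul (c := d / (2 * δ) * ‖x‖ ^ 2) fun t ht0 ht1 => ?_
  have hgt : (1 - t) • g + t • g' ∈ F := hF h.2.1 hg' (by linarith) ht0.le (by ring)
  have hft : (1 - t) • f + t • f' ∈ F := hF h.1 hf' (by linarith) ht0.le (by ring)
  have hK : K ((1 - t) • g + t • g' - ((1 - t) • f + t • f')) = u + t • x := by
    simp only [hx, hu, map_sub, map_add, map_smul]
    module
  -- By AM-GM, `η` bounds `‖u + t • x‖`. It is quadratic in `t`, equals `δ` at `t = 0` and has slope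
  -- `⟨u, x⟩ / δ` there, so the norm need not be differentiated.
  set η := (‖u + t • x‖ ^ 2 + δ ^ 2) / (2 * δ) with hη_def
  have hη : 0 < η := by positivity
  have hle : ‖u + t • x‖ ≤ η := by
    rw [hη_def, le_div_iff₀ (by positivity)]
    nlinarith [sq_nonneg (‖u + t • x‖ - δ)]
  obtain ⟨f₁, g₁, h₁⟩ := hsol η hη
  have h2 := h₁.le_modulus hft hgt (hK ▸ hle)
  have h3 := hd η hη
  have h4 : η - δ = t * (inner ℝ u x / δ + t * ‖x‖ ^ 2 / (2 * δ)) := by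
    rw [hη_def, norm_add_sq_real, hn, inner_smul_right, norm_smul, Real.norm_of_nonneg ht0.le]
    field_simp
    ring
  rw [h4] at h3
  have h5 := h.modulus_eq
  simp only [map_add, map_smul, smul_eq_mul] at h2
  have h6 : t * (L g' - L f' - modulus F K L δ)
      ≤ t * (d / δ * inner ℝ u x + t * (d / (2 * δ) * ‖x‖ ^ 2)) := by
    calc t * (L g' - L f' - modulus F K L δ)
        = (1 - t) * L g + t * L g' - ((1 - t) * L f + t * L f') - modulus F K L δ := by
          rw [h5]; ring
      _ ≤ d * (t * (inner ℝ u x / δ + t * ‖x‖ ^ 2 / (2 * δ))) := by linarith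
      _ = _ := by ring
  exact le_of_mul_le_mul_left h6 ht0

end Modulus

/-! ### Worst-case bias and the fixed-length interval. -/

section FixedLength

variable {V 𝒴 Ω : Type*} [AddCommGroup V] [Module ℝ V]
  [NormedAddCommGroup 𝒴] [InnerProductSpace ℝ 𝒴] [MeasurableSpace Ω]
  {P : Measure Ω} {ε : 𝒴 → Ω → ℝ} {F : Set V} {K : V →ₗ[ℝ] 𝒴} {L : V →ₗ[ℝ] ℝ}

/-- The coverage of the fixed-length interval around an affine estimator, in terms of its bias. -/
theorem dataLaw_modulusEstimator (hε : IsStandardGaussian ε P) {σ δ d : ℝ} (hσ : 0 < σ)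
    (hδ : 0 < δ) (hd : 0 < d) {f g : V} (hn : ‖K (g - f)‖ = δ) (h : V) (χ : ℝ) :
    dataLaw K σ ε P h {y | |modulusEstimator K L δ d f g y - L h| ≤ χ}
      = gaussianReal 0 1 {x | |(L ((1 / 2 : ℝ) • (f + g)) - L h
          + d / δ * inner ℝ (K (g - f)) (K (h - (1 / 2 : ℝ) • (f + g)))) / (σ * d) + x|
          ≤ χ / (σ * d)} := by
  have hs : 0 < σ * d := mul_pos hσ hd
  unfold modulusEstimator
  rw [dataLaw_setOf hε K σ h (K (g - f)) (p := fun x => |L ((1 / 2 : ℝ) • (f + g))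
    + d / δ * (x - inner ℝ (K ((1 / 2 : ℝ) • (f + g))) (K (g - f))) - L h| ≤ χ)
    (measurableSet_le (by fun_prop) (by fun_prop)), hn]
  congr 1
  ext x
  have habs : ∀ a : ℝ, |a| * (σ * d) = |a * (σ * d)| := fun a => by rw [abs_mul, abs_of_pos hs]
  rw [Set.mem_ofPred_eq, Set.mem_ofPred_eq, le_div_iff₀ hs, habs, map_sub K h,
    inner_sub_right, real_inner_comm (K h), real_inner_comm (K (_ • _))]
  refine iff_of_eq (congrArg (fun r => |r| ≤ χ) ?_)
  field_simp
  ring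

/-- The half-lengths of the valid fixed-length intervals around the modulus estimator. -/
theorem validHalfLengths_modulusEstimator (hε : IsStandardGaussian ε P) {σ α : ℝ} (hσ : 0 < σ)
    (hα0 : 0 < α) (hα1 : α < 1) (hF : Convex ℝ F)
    (hsol : ∀ δ > 0, ∃ f g, IsModulusSolution F K L δ f g)
    {δ d : ℝ} (hδ : 0 < δ) (hd : d ∈ modulusSuperdiff F K L δ) (hd0 : 0 < d)
    {f g : V} (h : IsModulusSolution F K L δ f g) :
    validHalfLengths F K L σ ε P α (modulusEstimator K L δ d f g)
      = Set.Ici (cv α (modulus F K L δ / (2 * σ * d) - δ / (2 * σ)) * (σ * d)) := by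
  have hs : 0 < σ * d := mul_pos hσ hd0
  have hn := h.norm_eq hsol hδ hd hd0
  have hmod := h.modulus_eq
  have hinner : inner ℝ (K (g - f)) (K (g - f)) = δ * δ := by
    rw [real_inner_self_eq_norm_mul_norm, hn]
  have hB : (modulus F K L δ - δ * d) / 2 / (σ * d)
      = modulus F K L δ / (2 * σ * d) - δ / (2 * σ) := by
    field_simp
  set bias : V → ℝ := fun h => L ((1 / 2 : ℝ) • (f + g)) - L h
          + d / δ * inner ℝ (K (g - f)) (K (h - (1 / 2 : ℝ) • (f + g))) with hbias
  -- The upper bound is the hyperplane inequality at the pair `(h', g)`, the lower bound the one at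
  -- `(f, h')`.
  have hle : ∀ h' ∈ F, |bias h'| ≤ (modulus F K L δ - δ * d) / 2 := by
    intro h' hh'
    have h1 := h.sub_modulus_le hF hsol hδ hd hd0 hh' h.2.1
    have h2 := h.sub_modulus_le hF hsol hδ hd hd0 h.1 hh'
    have e1 : K (h' - (1 / 2 : ℝ) • (f + g))
        = (1 / 2 : ℝ) • K (g - f) - (K (g - h')) := by
      simp only [map_sub, map_add, map_smul]; module
    have e2 : K (h' - (1 / 2 : ℝ) • (f + g))
        = K (h' - f) - (1 / 2 : ℝ) • K (g - f) := by
      simp only [map_sub, map_add, map_smul]; module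
    have b1 : bias h' = (L g + L f) / 2 - L h'
        + d / δ * (δ * δ / 2 - inner ℝ (K (g - f)) (K (g - h'))) := by
      simp only [hbias]
      rw [e1, inner_sub_right, inner_smul_right, hinner, map_smul, map_add, smul_eq_mul]
      ring
    have b2 : bias h' = (L g + L f) / 2 - L h'
        + d / δ * (inner ℝ (K (g - f)) (K (h' - f)) - δ * δ / 2) := by
      simp only [hbias]
      rw [e2, inner_sub_right, inner_smul_right, hinner, map_smul, map_add, smul_eq_mul]
      ring
    rw [inner_sub_right, hinner] at h1 h2
    have e3 : d / δ * (δ * δ) = d * δ := by field_simp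
    rw [abs_le]
    constructor
    · rw [b2]
      linarith
    · rw [b1]
      linarith
  have heq : bias f = (modulus F K L δ - δ * d) / 2 := by
    have e2 : K (f - (1 / 2 : ℝ) • (f + g)) = (-(1 / 2) : ℝ) • K (g - f) := by
      simp only [map_sub, map_add, map_smul]; module
    simp only [hbias]
    rw [e2, inner_smul_right, hinner, hmod, map_smul, map_add, smul_eq_mul]
    field_simp
    ring
  ext χ
  rw [Set.mem_Ici, ← le_div_iff₀ hs, ← le_gaussianReal_setOf_abs_iff_cv_le hα0 hα1, ← hB,
    validHalfLengths, Set.mem_ofPred_eq]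
  simp_rw [dataLaw_modulusEstimator hε hσ hδ hd0 hn]
  constructor
  · intro hχ
    have := hχ f h.1
    rwa [show L ((1 / 2 : ℝ) • (f + g)) - L f
          + d / δ * inner ℝ (K (g - f)) (K (f - (1 / 2 : ℝ) • (f + g))) = bias f from rfl,
      heq] at this
  · intro hχ h' hh'
    refine hχ.trans (gaussianReal_setOf_abs_add_le_anti ?_ _)
    rw [abs_div, abs_div]
    exact div_le_div_of_nonneg_right ((hle h' hh').trans (le_abs_self _)) (abs_nonneg _)

end FixedLength

/-! ### The smallest expected length at `g`. -/

section OptimalLength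

variable {V 𝒴 Ω : Type*} [AddCommGroup V] [Module ℝ V]
  [NormedAddCommGroup 𝒴] [InnerProductSpace ℝ 𝒴] [MeasurableSpace Ω]
  {P : Measure Ω} {ε : 𝒴 → Ω → ℝ} {F : Set V} {K : V →ₗ[ℝ] 𝒴} {L : V →ₗ[ℝ] ℝ}
  {g : V} {φ : ℝ → V}

/-- The optimal value of a convex program is convex in the constraint level `t`, and a finite convex
function on the line is continuous. -/
theorem continuous_norm_of_minimizers (hF : Convex ℝ F) (hφF : ∀ t, φ t ∈ F)
    (hφL : ∀ t, L (φ t) = t) (hφ : ∀ t, ∀ f ∈ F, L f = t → ‖K (g - φ t)‖ ≤ ‖K (g - f)‖) :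
    Continuous fun t => ‖K (g - φ t)‖ := by
  have hconv : ConvexOn ℝ Set.univ fun t => ‖K (g - φ t)‖ := by
    refine ⟨convex_univ, fun s _ t _ a b ha hb hab => ?_⟩
    have hle := hφ (a • s + b • t) (a • φ s + b • φ t) (hF (hφF s) (hφF t) ha hb hab)
      (by simp [hφL])
    refine hle.trans ?_
    have h1 : K (g - (a • φ s + b • φ t)) = a • K (g - φ s) + b • K (g - φ t) := by
      have : g = a • g + b • g := by rw [← add_smul, hab, one_smul]
      conv_lhs => rw [this]
      simp only [map_sub, map_add, map_smul]
      module
    rw [h1]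
    refine (norm_add_le _ _).trans ?_
    simp [norm_smul, abs_of_nonneg ha, abs_of_nonneg hb]
  exact continuousOn_univ.1 (hconv.continuousOn isOpen_univ)

/-- The minimal-distance residual depends continuously on the constrained value of `L`. -/
theorem continuous_of_minimizers (hF : Convex ℝ F) (hφF : ∀ t, φ t ∈ F)
    (hφL : ∀ t, L (φ t) = t) (hφ : ∀ t, ∀ f ∈ F, L f = t → ‖K (g - φ t)‖ ≤ ‖K (g - f)‖) :
    Continuous fun t => K (g - φ t) := by
  have hc := continuous_norm_of_minimizers hF hφF hφL hφ
  set D : ℝ → ℝ := fun t => ‖K (g - φ t)‖ with hD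
  -- The midpoint of `φ t` and `φ s` competes at the midpoint level, so the parallelogram law
  -- controls the residuals by their norms alone.
  have hbound : ∀ s t, ‖K (g - φ t) - K (g - φ s)‖ ^ 2
      ≤ 2 * D t ^ 2 + 2 * D s ^ 2 - 4 * D ((1 / 2) * t + (1 / 2) * s) ^ 2 := by
    intro s t
    have hle := hφ ((1 / 2) * t + (1 / 2) * s) ((1 / 2 : ℝ) • φ t + (1 / 2 : ℝ) • φ s)
      (hF (hφF t) (hφF s) (by norm_num) (by norm_num) (by norm_num)) (by simp [hφL])
    have h1 : K (g - ((1 / 2 : ℝ) • φ t + (1 / 2 : ℝ) • φ s))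
        = (1 / 2 : ℝ) • (K (g - φ t) + K (g - φ s)) := by
      simp only [map_sub, map_add, map_smul]
      module
    rw [h1, norm_smul, Real.norm_of_nonneg (by norm_num)] at hle
    have hpar := parallelogram_law_with_norm ℝ (K (g - φ t)) (K (g - φ s))
    have h2 : D ((1 / 2) * t + (1 / 2) * s) ^ 2
        ≤ (1 / 2 * ‖K (g - φ t) + K (g - φ s)‖) ^ 2 := by
      have : 0 ≤ D ((1 / 2) * t + (1 / 2) * s) := norm_nonneg _
      gcongr
    simp only [hD] at h2 ⊢
    nlinarith
  rw [continuous_iff_continuousAt]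
  intro s
  rw [ContinuousAt, tendsto_iff_norm_sub_tendsto_zero]
  have hlim : Filter.Tendsto (fun t => 2 * D t ^ 2 + 2 * D s ^ 2
      - 4 * D ((1 / 2) * t + (1 / 2) * s) ^ 2) (nhds s) (nhds 0) := by
    have hcont : Continuous fun t => 2 * D t ^ 2 + 2 * D s ^ 2
      - 4 * D ((1 / 2) * t + (1 / 2) * s) ^ 2 := by fun_prop
    have := hcont.tendsto s
    rw [show (1 / 2) * s + (1 / 2) * s = s by ring] at this
    convert this using 2
    ring
  have h2 := (squeeze_zero (fun _ => sq_nonneg _) (hbound s) hlim).sqrt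
  simpa [Real.sqrt_sq (norm_nonneg _)] using h2

/-- The variational inequality of the constrained distance minimizer. -/
theorem inner_nonpos_of_minimizers (hF : Convex ℝ F) (hφF : ∀ t, φ t ∈ F)
    (hφL : ∀ t, L (φ t) = t) (hφ : ∀ t, ∀ f ∈ F, L f = t → ‖K (g - φ t)‖ ≤ ‖K (g - f)‖)
    {f : V} (hf : f ∈ F) :
    inner ℝ (K f) (K (g - φ (L f))) ≤ inner ℝ (K (φ (L f))) (K (g - φ (L f))) := by
  set v := K (g - φ (L f)) with hv
  set x := K f - K (φ (L f)) with hx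
  have key : 2 * inner ℝ v x ≤ 0 := by
    refine le_of_forall_le_add_mul (c := ‖x‖ ^ 2) fun t ht0 ht1 => ?_
    have hle := hφ (L f) ((1 - t) • φ (L f) + t • f)
      (hF (hφF _) hf (by linarith) ht0.le (by ring)) (by simp [hφL]; ring)
    have h1 : K (g - ((1 - t) • φ (L f) + t • f)) = v - t • x := by
      simp only [hv, hx, map_sub, map_add, map_smul]
      module
    rw [h1] at hle
    have h2 : ‖v‖ ^ 2 ≤ ‖v - t • x‖ ^ 2 := by gcongr
    rw [norm_sub_sq_real, inner_smul_right, norm_smul, Real.norm_of_nonneg ht0.le] at h2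
    have h3 : t * (2 * inner ℝ v x) ≤ t * (0 + t * ‖x‖ ^ 2) := by nlinarith
    exact le_of_mul_le_mul_left h3 ht0
  rw [hx, inner_sub_right, real_inner_comm, real_inner_comm (K (φ (L f)))] at key
  linarith

/-- Under centrosymmetry, the attainable values of `L` at distance at most `δ` from `g` form an
interval whose length is the modulus at `2 δ`. -/
theorem setOf_norm_minimizers_le (hF : Convex ℝ F) (hg : g ∈ F) (hsymm : ∀ f ∈ F, -f ∈ F)
    (hgF : ∀ f ∈ F, f - g ∈ F) (hsol : ∀ δ > 0, ∃ f g, IsModulusSolution F K L δ f g)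
    (hφF : ∀ t, φ t ∈ F)
    (hφL : ∀ t, L (φ t) = t) (hφ : ∀ t, ∀ f ∈ F, L f = t → ‖K (g - φ t)‖ ≤ ‖K (g - f)‖)
    {δ : ℝ} (hδ : 0 < δ) :
    {t | ‖K (g - φ t)‖ ≤ δ}
      = Set.Icc (L g - modulus F K L (2 * δ) / 2) (L g + modulus F K L (2 * δ) / 2) := by
  obtain ⟨f₀, g₀, h₀⟩ := hsol (2 * δ) (by linarith)
  ext t
  rw [Set.mem_ofPred_eq, Set.mem_Icc]
  constructor
  · intro ht
    have hh : φ t - g ∈ F := hgF _ (hφF t)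
    have hn : ‖K ((φ t - g) - -(φ t - g))‖ ≤ 2 * δ := by
      have : K ((φ t - g) - -(φ t - g)) = (-2 : ℝ) • K (g - φ t) := by
        simp only [map_sub, map_neg]
        module
      rw [this, norm_smul, norm_neg, Real.norm_ofNat]
      linarith
    have h1 := h₀.le_modulus (hsymm _ hh) hh hn
    have h2 := h₀.le_modulus hh (hsymm _ hh) (by rwa [← norm_neg, ← map_neg, neg_sub])
    simp only [map_neg, map_sub, hφL] at h1 h2
    constructor <;> linarith
  · rintro ⟨h1, h2⟩
    set m := modulus F K L (2 * δ) / 2 with hm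
    -- Symmetrizing a modulus solution gives `h ∈ F` with `‖K h‖ ≤ δ` and `L h` half the modulus.
    -- The points `g + c • h` with `|c| ≤ 1` then sweep out the interval.
    set h := (1 / 2 : ℝ) • (g₀ - f₀) with hh
    have h0F : (0 : V) ∈ F := by simpa using hgF g hg
    have hhF : h ∈ F := by
      have := hF h₀.2.1 (hsymm _ h₀.1) (by norm_num : (0 : ℝ) ≤ 1 / 2)
        (by norm_num : (0 : ℝ) ≤ 1 / 2) (by norm_num)
      rwa [← smul_add, ← sub_eq_add_neg] at this
    have hLh : L h = m := by
      rw [hh, hm, h₀.modulus_eq, map_smul, map_sub, smul_eq_mul]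
      ring
    have hKh : ‖K h‖ ≤ δ := by
      rw [hh, map_smul, norm_smul, Real.norm_of_nonneg (by norm_num)]
      linarith [h₀.2.2.1]
    have hm0 : 0 ≤ m := by linarith
    obtain ⟨c, hc, hct⟩ : ∃ c : ℝ, |c| ≤ 1 ∧ t = L g + c * m := by
      refine ⟨(t - L g) / m, ?_, ?_⟩
      · rw [abs_div, abs_of_nonneg hm0]
        refine div_le_one_of_le₀ (abs_le.2 ⟨?_, ?_⟩) hm0 <;> linarith
      -- If `m = 0` the quotient is `0` by convention, and the interval is the single point `L g`.
      · rcases hm0.eq_or_lt with h | h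
        · rw [← h] at h1 h2 ⊢
          simp at h1 h2 ⊢
          exact le_antisymm h2 h1
        · field_simp
          ring
    have hchF : c • h ∈ F := by
      rcases le_total 0 c with h | h
      · exact hF.smul_mem_of_zero_mem h0F hhF ⟨h, (le_abs_self c).trans hc⟩
      · have := hF.smul_mem_of_zero_mem h0F (hsymm _ hhF)
          (t := -c) ⟨by linarith, (neg_le_abs c).trans hc⟩
        simpa using this
    have hmem : g + c • h ∈ F := by
      have := hsymm _ (hgF _ (hsymm _ hchF))
      rwa [neg_sub, sub_neg_eq_add] at this
    have hle := hφ t (g + c • h) hmem (by rw [map_add, map_smul, hLh, hct, smul_eq_mul])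
    refine hle.trans ?_
    rw [sub_add_cancel_left, map_neg, norm_neg, map_smul, norm_smul, Real.norm_eq_abs]
    calc |c| * ‖K h‖ ≤ 1 * δ := by gcongr
      _ = δ := one_mul _

theorem expectedLength_eq_lintegral [IsProbabilityMeasure P] (hε : IsStandardGaussian ε P) {σ : ℝ}
    {C : (𝒴 → ℝ) → Set ℝ} (hC : MeasurableSet {p : (𝒴 → ℝ) × ℝ | p.2 ∈ C p.1}) :
    expectedLength K σ ε P g C = ∫⁻ t, dataLaw K σ ε P g {y | t ∈ C y} := by
  have := isProbabilityMeasure_dataLaw hε K σ g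
  have h1 := Measure.prod_apply (μ := dataLaw K σ ε P g) (ν := volume) hC
  have h2 := Measure.prod_apply_symm (μ := dataLaw K σ ε P g) (ν := (volume : Measure ℝ)) hC
  exact h1.symm.trans h2

theorem exists_gaussianReal_setOf_abs_eq {α : ℝ} (hα0 : 0 < α) (hα1 : α < 1) :
    ∃ c : ℝ, gaussianReal 0 1 {x | |0 + x| ≤ c} = ENNReal.ofReal α := by
  have := nullSingletonClass_gaussianReal (μ := 0) (v := 1) one_ne_zero
  have : IsProbabilityMeasure ((gaussianReal 0 1).map (fun x => |x|)) :=
    Measure.isProbabilityMeasure_map (by fun_prop)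
  refine ⟨quantile ((gaussianReal 0 1).map (fun x => |x|)) α, ?_⟩
  rw [← cdf_map_abs_gaussianReal, cdf_quantile _ hα0 hα1]
  rw [Measure.map_apply (by fun_prop) (measurableSet_singleton _)]
  set q := quantile ((gaussianReal 0 1).map (fun x => |x|)) α
  refine measure_mono_null (t := {q, -q}) ?_ ((Set.toFinite _).measure_zero _)
  intro x hx
  exact eq_or_eq_neg_of_abs_eq hx

/-- There is a nonrandomized acceptance region with probability exactly `1 - α` under `g` and at
least `1 - α` under every parameter. -/
theorem exists_acceptance_region [IsProbabilityMeasure P] [Nontrivial 𝒴]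
    (hε : IsStandardGaussian ε P) {σ α : ℝ} (hσ : 0 < σ) (hα0 : 0 < α) (hα1 : α < 1)
    (K : V →ₗ[ℝ] 𝒴) (g : V) :
    ∃ A : Set (𝒴 → ℝ), MeasurableSet A ∧ dataLaw K σ ε P g A = ENNReal.ofReal (1 - α) ∧
      ∀ f, ENNReal.ofReal (1 - α) ≤ dataLaw K σ ε P f A := by
  -- `A` is the complement of an interval of probability `α` centered at the mean of `⟨Y, u⟩` under
  -- `g`. Any other mean lowers the probability of the interval, hence raises that of `A`.
  obtain ⟨u, hu⟩ := exists_ne (0 : 𝒴)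
  have hn : 0 < σ * ‖u‖ := mul_pos hσ (norm_pos_iff.2 hu)
  obtain ⟨c, hc⟩ := exists_gaussianReal_setOf_abs_eq hα0 hα1
  have hm : MeasurableSet {y : 𝒴 → ℝ | |y u - inner ℝ (K g) u| ≤ c * (σ * ‖u‖)} :=
    measurableSet_le (by fun_prop) (by fun_prop)
  have hlaw : ∀ f, dataLaw K σ ε P f {y : 𝒴 → ℝ | |y u - inner ℝ (K g) u| ≤ c * (σ * ‖u‖)}
      = gaussianReal 0 1 {x | |(inner ℝ (K f) u - inner ℝ (K g) u) / (σ * ‖u‖) + x| ≤ c} := by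
    intro f
    rw [dataLaw_setOf hε K σ f u (p := fun x => |x - inner ℝ (K g) u| ≤ c * (σ * ‖u‖))
      (measurableSet_le (by fun_prop) (by fun_prop))]
    congr 1
    ext x
    rw [Set.mem_ofPred_eq, Set.mem_ofPred_eq, ← div_le_iff₀ hn]
    nth_rewrite 1 [← abs_of_pos hn]
    rw [← abs_div]
    refine iff_of_eq (congrArg (fun r => |r| ≤ c) ?_)
    field_simp
    ring
  have hsub : ENNReal.ofReal (1 - α) = 1 - ENNReal.ofReal α := by
    rw [ENNReal.ofReal_sub _ hα0.le, ENNReal.ofReal_one]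
  refine ⟨_, hm.compl, ?_, fun f => ?_⟩
  · have := isProbabilityMeasure_dataLaw hε K σ g
    rw [prob_compl_eq_one_sub hm, hlaw, sub_self, zero_div, hc, hsub]
  · have := isProbabilityMeasure_dataLaw hε K σ f
    rw [prob_compl_eq_one_sub hm, hlaw, hsub, ← hc]
    exact tsub_le_tsub_left (gaussianReal_setOf_abs_add_le_anti (by simp) _) _

/-- The confidence set obtained by inverting the most powerful tests against `g`. -/
theorem exists_optimal_confidenceSet [IsProbabilityMeasure P] [Nontrivial 𝒴]
    (hε : IsStandardGaussian ε P) {σ α : ℝ} (hσ : 0 < σ) (hα0 : 0 < α) (hα1 : α < 1)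
    (hF : Convex ℝ F) (hφF : ∀ t, φ t ∈ F)
    (hφL : ∀ t, L (φ t) = t) (hφ : ∀ t, ∀ f ∈ F, L f = t → ‖K (g - φ t)‖ ≤ ‖K (g - f)‖) :
    ∃ C ∈ confidenceSets F K L σ ε P α, ∀ t, dataLaw K σ ε P g {y | t ∈ C y}
      = gaussianReal 0 1 (Set.Iic (zq (1 - α) - ‖K (g - φ t)‖ / σ)) := by
  have hc := continuous_of_minimizers hF hφF hφL hφ
  obtain ⟨A, hAm, hAg, hA⟩ := exists_acceptance_region hε hσ hα0 hα1 K g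
  obtain ⟨X, hXm, hX⟩ := exists_measurable_modification hε K σ hc
  set z := zq (1 - α) with hz
  have hzα : gaussianReal 0 1 (Set.Iic z) = ENNReal.ofReal (1 - α) :=
    gaussianReal_Iic_zq (by linarith) (by linarith)
  -- The critical value is the `1 - α` quantile of `⟨Y, K (g - φ t)⟩` under `φ t`.
  set θ : ℝ → ℝ := fun t => inner ℝ (K (φ t)) (K (g - φ t)) + σ * (z * ‖K (g - φ t)‖) with hθ
  have hθc : Continuous θ := by
    have : ∀ t, K (φ t) = K g - K (g - φ t) := fun t => by simp
    simp only [hθ]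
    simp_rw [this]
    exact ((continuous_const.sub hc).inner hc).add
      (continuous_const.mul (continuous_const.mul hc.norm))
  have hlaw : ∀ f t, dataLaw K σ ε P f {y | X (y, t) ≤ θ t}
      = gaussianReal 0 1 {x | inner ℝ (K f) (K (g - φ t)) + σ * (‖K (g - φ t)‖ * x) ≤ θ t} := by
    intro f t
    rw [← dataLaw_setOf hε K σ f (K (g - φ t)) (p := fun x => x ≤ θ t) measurableSet_Iic]
    refine measure_congr ?_
    filter_upwards [hX f t] with y hy
    exact congrArg (· ≤ θ t) hy
  -- If `K (g - φ t) = 0`, the test statistic degenerates and would accept with probability one. The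
  -- region `A` restores probability exactly `1 - α` under `g`.
  refine ⟨fun y => {t | (‖K (g - φ t)‖ = 0 ∧ y ∈ A) ∨ (‖K (g - φ t)‖ ≠ 0 ∧ X (y, t) ≤ θ t)},
    ⟨?_, fun f hf => ?_⟩, fun t => ?_⟩
  · have h0 : MeasurableSet {p : (𝒴 → ℝ) × ℝ | ‖K (g - φ p.2)‖ = 0} :=
      measurableSet_eq_fun (hc.norm.measurable.comp measurable_snd) measurable_const
    exact (h0.inter (measurable_fst hAm)).union (h0.compl.inter
      (measurableSet_le hXm (hθc.measurable.comp measurable_snd)))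
  · by_cases h0 : ‖K (g - φ (L f))‖ = 0
    · refine (hA f).trans (measure_mono fun y hy => Or.inl ⟨h0, hy⟩)
    · refine le_trans ?_ (measure_mono (s := {y | X (y, L f) ≤ θ (L f)})
        fun y hy => Or.inr ⟨h0, hy⟩)
      rw [hlaw, ← hzα]
      refine measure_mono fun x hx => ?_
      have h1 := inner_nonpos_of_minimizers hF hφF hφL hφ hf
      have h2 : σ * (‖K (g - φ (L f))‖ * x) ≤ σ * (z * ‖K (g - φ (L f))‖) := by
        rw [mul_comm z]
        gcongr
        exact hx
      exact add_le_add h1 h2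
  · by_cases h0 : ‖K (g - φ t)‖ = 0
    · have : {y | t ∈ {t | (‖K (g - φ t)‖ = 0 ∧ y ∈ A) ∨
          (‖K (g - φ t)‖ ≠ 0 ∧ X (y, t) ≤ θ t)}} = A := by
        ext y
        simp only [Set.mem_ofPred_eq, h0, ne_eq, not_true_eq_false, true_and, false_and, or_false]
      rw [this, hAg, h0, zero_div, sub_zero, hzα]
    · have : {y | t ∈ {t | (‖K (g - φ t)‖ = 0 ∧ y ∈ A) ∨
          (‖K (g - φ t)‖ ≠ 0 ∧ X (y, t) ≤ θ t)}} = {y | X (y, t) ≤ θ t} := by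
        ext y
        simp only [Set.mem_ofPred_eq, h0, ne_eq, not_false_eq_true, true_and, false_and, false_or]
      rw [this, hlaw]
      congr 1
      ext x
      have hn : 0 < ‖K (g - φ t)‖ := lt_of_le_of_ne (norm_nonneg _) (Ne.symm h0)
      have h3 : inner ℝ (K g) (K (g - φ t))
          = inner ℝ (K (φ t)) (K (g - φ t)) + ‖K (g - φ t)‖ * ‖K (g - φ t)‖ := by
        rw [← real_inner_self_eq_norm_mul_norm, ← inner_add_left]
        simp
      rw [Set.mem_ofPred_eq, Set.mem_Iic, h3, le_sub_iff_add_le,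
        ← mul_le_mul_iff_right₀ (mul_pos hσ hn) (b := x + _)]
      have h4 : σ * ‖K (g - φ t)‖ * (x + ‖K (g - φ t)‖ / σ)
          = ‖K (g - φ t)‖ * ‖K (g - φ t)‖ + σ * (‖K (g - φ t)‖ * x) := by
        field_simp
        ring
      have h5 : σ * ‖K (g - φ t)‖ * z = σ * (z * ‖K (g - φ t)‖) := by ring
      rw [h4, h5, hθ, add_assoc, add_le_add_iff_left]

theorem optimalExpectedLength_eq_lintegral [IsProbabilityMeasure P] [Nontrivial 𝒴]
    (hε : IsStandardGaussian ε P) {σ α : ℝ} (hσ : 0 < σ) (hα0 : 0 < α) (hα1 : α < 1)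
    (hF : Convex ℝ F) (hφF : ∀ t, φ t ∈ F)
    (hφL : ∀ t, L (φ t) = t) (hφ : ∀ t, ∀ f ∈ F, L f = t → ‖K (g - φ t)‖ ≤ ‖K (g - f)‖) :
    optimalExpectedLength F K L σ ε P α g
      = ∫⁻ t, gaussianReal 0 1 (Set.Iic (zq (1 - α) - ‖K (g - φ t)‖ / σ)) := by
  apply le_antisymm
  · obtain ⟨C, hC, hCg⟩ := exists_optimal_confidenceSet hε hσ hα0 hα1 hF hφF hφL hφ
    refine (iInf₂_le C hC).trans ?_
    rw [expectedLength_eq_lintegral hε hC.1]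
    simp_rw [hCg]
    exact le_rfl
  · refine le_iInf₂ fun C hC => ?_
    rw [expectedLength_eq_lintegral hε hC.1]
    refine lintegral_mono fun t => ?_
    refine dataLaw_neyman_pearson hε K hσ (φ t) g (measurable_prodMk_right hC.1) ?_
    rw [gaussianReal_Iic_zq (by linarith) (by linarith)]
    have := hC.2 (φ t) (hφF t)
    rwa [hφL] at this

/-- Both sides measure the region `s ≤ z - ‖K (g - φ t)‖ / σ` of the `(t, s)` plane, sliced in the
two directions. -/
theorem lintegral_gaussianReal_Iic_eq (hF : Convex ℝ F) (hg : g ∈ F) (hsymm : ∀ f ∈ F, -f ∈ F)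
    (hgF : ∀ f ∈ F, f - g ∈ F) (hsol : ∀ δ > 0, ∃ f g, IsModulusSolution F K L δ f g)
    (hφF : ∀ t, φ t ∈ F)
    (hφL : ∀ t, L (φ t) = t) (hφ : ∀ t, ∀ f ∈ F, L f = t → ‖K (g - φ t)‖ ≤ ‖K (g - f)‖)
    {σ : ℝ} (hσ : 0 < σ) (z : ℝ) :
    ∫⁻ t, gaussianReal 0 1 (Set.Iic (z - ‖K (g - φ t)‖ / σ))
      = ∫⁻ s in Set.Iic z, ENNReal.ofReal (modulus F K L (2 * σ * (z - s)))
        ∂gaussianReal 0 1 := by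
  have := nullSingletonClass_gaussianReal (μ := 0) (v := 1) one_ne_zero
  have hc := continuous_norm_of_minimizers hF hφF hφL hφ
  have hm : MeasurableSet {p : ℝ × ℝ | p.2 ≤ z - ‖K (g - φ p.1)‖ / σ} :=
    measurableSet_le measurable_snd
      (((hc.measurable.comp measurable_fst).div_const σ).const_sub z)
  have h1 := Measure.prod_apply (μ := (volume : Measure ℝ)) (ν := gaussianReal 0 1) hm
  have h2 := Measure.prod_apply_symm (μ := (volume : Measure ℝ)) (ν := gaussianReal 0 1) hm
  refine (h1.symm.trans h2).trans ?_
  rw [← lintegral_indicator measurableSet_Iic]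
  -- At `s = z` the radius is zero, which `setOf_norm_minimizers_le` excludes.
  have hae : ∀ᵐ s ∂gaussianReal 0 1, s ≠ z := by
    rw [ae_iff]
    simp
  refine lintegral_congr_ae ?_
  filter_upwards [hae] with s hs
  have hset : (fun t => (t, s)) ⁻¹' {p : ℝ × ℝ | p.2 ≤ z - ‖K (g - φ p.1)‖ / σ}
      = {t | ‖K (g - φ t)‖ ≤ σ * (z - s)} := by
    ext t
    simp only [Set.mem_preimage, Set.mem_ofPred_eq]
    rw [le_sub_comm, div_le_iff₀' hσ]
  rw [hset]
  rcases lt_or_gt_of_ne hs with h | h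
  · rw [Set.indicator_of_mem (Set.mem_Iic.2 h.le), setOf_norm_minimizers_le hF hg hsymm hgF hsol
      hφF hφL hφ (mul_pos hσ (sub_pos.2 h)), Real.volume_Icc, ← mul_assoc]
    congr 1
    ring
  · rw [Set.indicator_of_notMem (by simpa using h)]
    have : {t | ‖K (g - φ t)‖ ≤ σ * (z - s)} = ∅ := by
      refine Set.eq_empty_of_forall_notMem fun t ht => ?_
      have h3 : σ * (z - s) < 0 := mul_neg_of_pos_of_neg hσ (by linarith)
      exact absurd (lt_of_le_of_lt ht h3) (norm_nonneg _).not_gt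
    rw [this, measure_empty]

/-- A supergradient at `1` bounds the modulus by an affine function, which is integrable under the
Gaussian. The argument is enlarged to `|·| + 1` because the supergradient inequality only covers
positive arguments. -/
theorem integrable_modulus (hne : F.Nonempty)
    (hsol : ∀ δ > 0, ∃ f g, IsModulusSolution F K L δ f g) {d : ℝ}
    (hd : d ∈ modulusSuperdiff F K L 1) (σ z : ℝ) :
    Integrable (fun s => modulus F K L (2 * σ * (z - s))) (gaussianReal 0 1) := by
  have hid : Integrable (fun s : ℝ => s) (gaussianReal 0 1) :=
    memLp_one_iff_integrable.1 (memLp_id_gaussianReal' 1 (by simp))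
  have hb : Integrable (fun s => |modulus F K L 1| + |d| * (|2 * σ * (z - s)| + 2))
      (gaussianReal 0 1) := by
    refine (integrable_const _).add (Integrable.const_mul (Integrable.add ?_ (integrable_const _)) _)
    exact (((integrable_const z).sub hid).const_mul (2 * σ)).abs
  refine hb.mono' ?_ (.of_forall fun s => ?_)
  · exact ((modulus_monotone hne hsol).measurable.comp (by fun_prop)).aestronglyMeasurable
  · rw [Real.norm_of_nonneg (modulus_nonneg hne hsol _)]
    have h1 := modulus_monotone hne hsol
      (show 2 * σ * (z - s) ≤ |2 * σ * (z - s)| + 1 by linarith [le_abs_self (2 * σ * (z - s))])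
    have h2 := hd (|2 * σ * (z - s)| + 1) (by positivity)
    have h3 : d * (|2 * σ * (z - s)| + 1 - 1) ≤ |d| * (|2 * σ * (z - s)| + 2) := by
      have : 0 ≤ |2 * σ * (z - s)| := abs_nonneg _
      have := abs_nonneg d
      have : d * (|2 * σ * (z - s)| + 1 - 1) ≤ |d| * (|2 * σ * (z - s)| + 1 - 1) := by
        rw [add_sub_cancel_right]
        gcongr
        exact le_abs_self d
      nlinarith
    linarith [le_abs_self (modulus F K L 1)]

end OptimalLength

end HonestCI

/-! ### The efficiency formula. -/

open HonestCI in
theorem corollary3p5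
    {V 𝒴 Ω : Type*} [AddCommGroup V] [Module ℝ V]
    [NormedAddCommGroup 𝒴] [InnerProductSpace ℝ 𝒴] [CompleteSpace 𝒴]
    [MeasurableSpace Ω] (P : Measure Ω) [IsProbabilityMeasure P]
    (ε : 𝒴 → Ω → ℝ) (hε : IsStandardGaussian ε P)
    (σ : ℝ) (hσ : 0 < σ) (α : ℝ) (hα0 : 0 < α) (hα1 : α < 1)
    (K : V →ₗ[ℝ] 𝒴) (L : V →ₗ[ℝ] ℝ) (F : Set V) (hF : Convex ℝ F)
    (g : V) (hg : g ∈ F)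
    -- for every `L₀` there is a minimizer of `‖K (g - f)‖` subject to `L f = L₀`, `f ∈ F`
    (hmin : ∀ L₀ : ℝ, ∃ f ∈ F, L f = L₀ ∧ ∀ f' ∈ F, L f' = L₀ → ‖K (g - f)‖ ≤ ‖K (g - f')‖)
    (hsymm : ∀ f ∈ F, -f ∈ F)
    (hgF : ∀ f ∈ F, f - g ∈ F)
    -- solutions `fs δ`, `gs δ` of the modulus problem and elements `ω' δ` of the superdifferential
    (fs gs : ℝ → V) (hsol : ∀ δ > 0, IsModulusSolution F K L δ (fs δ) (gs δ))
    (ω' : ℝ → ℝ) (hω' : ∀ δ > 0, ω' δ ∈ modulusSuperdiff F K L δ)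
    -- the estimators `Lhat δ` around which the fixed-length intervals are centered
    (Lhat : ℝ → (𝒴 → ℝ) → ℝ)
    (hLhat : ∀ δ, Lhat δ = modulusEstimator K L δ (ω' δ) (fs δ) (gs δ))
    -- `δχ` minimizes the half-length of the fixed-length interval around the estimator
    (δχ : ℝ) (hδχ : 0 < δχ)
    (hargmin : ∀ δ > 0,
      halfLength F K L σ ε P α (Lhat δχ) ≤ halfLength F K L σ ε P α (Lhat δ)) :
    IsLeast (validHalfLengths F K L σ ε P α (Lhat δχ)) (halfLength F K L σ ε P α (Lhat δχ)) ∧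
    0 < halfLength F K L σ ε P α (Lhat δχ) ∧
    optimalExpectedLength F K L σ ε P α g ≠ ⊤ ∧
    Integrable (fun z => modulus F K L (2 * σ * (zq (1 - α) - z)))
      (cond (gaussianReal 0 1) (Set.Iic (zq (1 - α)))) ∧
    (optimalExpectedLength F K L σ ε P α g).toReal / (2 * halfLength F K L σ ε P α (Lhat δχ)) =
      ((1 - α) * ∫ z, modulus F K L (2 * σ * (zq (1 - α) - z))
          ∂(cond (gaussianReal 0 1) (Set.Iic (zq (1 - α))))) /
        (2 * cv α (modulus F K L δχ / (2 * σ * ω' δχ) - δχ / (2 * σ)) * (σ * ω' δχ)) := by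

  have hsol' : ∀ δ > 0, ∃ f g, IsModulusSolution F K L δ f g := fun δ hδ => ⟨_, _, hsol δ hδ⟩
  choose φ hφF hφL hφ using hmin
  have hne : F.Nonempty := ⟨g, hg⟩
  have hL : ∀ t : ℝ, ∃ f ∈ F, L f = t := fun t => ⟨φ t, hφF t, hφL t⟩
  have hd0 : 0 < ω' δχ := modulusSuperdiff_pos hne hsol' hL hδχ (hω' δχ hδχ)
  have hs : 0 < σ * ω' δχ := mul_pos hσ hd0
  have hnorm := (hsol δχ hδχ).norm_eq hsol' hδχ (hω' δχ hδχ) hd0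
  -- The constraint binds at `δχ > 0`, so `𝒴` has a nonzero vector, as the region `A` requires.
  have : Nontrivial 𝒴 :=
    nontrivial_of_ne (K (gs δχ - fs δχ)) 0 (norm_pos_iff.1 (hnorm.symm ▸ hδχ))
  have hvalid := validHalfLengths_modulusEstimator hε hσ hα0 hα1 hF hsol' hδχ (hω' δχ hδχ) hd0
    (hsol δχ hδχ)
  rw [← hLhat] at hvalid
  have hhalf : halfLength F K L σ ε P α (Lhat δχ)
      = cv α (modulus F K L δχ / (2 * σ * ω' δχ) - δχ / (2 * σ)) * (σ * ω' δχ) := by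
    rw [halfLength, hvalid, csInf_Ici]
  set z := zq (1 - α) with hz
  have hzα : gaussianReal 0 1 (Set.Iic z) = ENNReal.ofReal (1 - α) :=
    gaussianReal_Iic_zq (by linarith) (by linarith)
  have hint := integrable_modulus hne hsol' (hω' 1 one_pos) σ z
  have hopt : optimalExpectedLength F K L σ ε P α g = ENNReal.ofReal
      (∫ s in Set.Iic z, modulus F K L (2 * σ * (z - s)) ∂gaussianReal 0 1) := by
    rw [optimalExpectedLength_eq_lintegral hε hσ hα0 hα1 hF hφF hφL hφ,
      lintegral_gaussianReal_Iic_eq hF hg hsymm hgF hsol' hφF hφL hφ hσ,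
      ofReal_integral_eq_lintegral_ofReal hint.integrableOn
        (.of_forall fun s => modulus_nonneg hne hsol' _)]
  refine ⟨?_, ?_, ?_, ?_, ?_⟩
  · rw [hhalf, hvalid]
    exact isLeast_Ici
  · rw [hhalf]
    exact mul_pos (cv_pos hα0 hα1 _) hs
  · rw [hopt]
    exact ENNReal.ofReal_ne_top
  · refine hint.integrableOn.smul_measure (ENNReal.inv_ne_top.2 ?_)
    rw [hzα]
    simpa using hα1
  · rw [hopt, ENNReal.toReal_ofReal (integral_nonneg fun s => modulus_nonneg hne hsol' _), hhalf,
      ProbabilityTheory.cond, integral_smul_measure, hzα, ENNReal.toReal_inv,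
      ENNReal.toReal_ofReal (by linarith), smul_eq_mul,
      mul_inv_cancel_left₀ (by linarith : 1 - α ≠ 0), mul_assoc 2 (cv _ _)]
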